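/- Let $d\in\{2,3\}$, $k\ge 1$, and let $\Omega\subset\mathbb R^d$ be a bounded polygonal ($d=2$) or polyhedral ($d=3$) domain. Let $\vec b$ be a $C^1$ vector field on $\Omega$, bounded together with its first derivatives, let $c$ be a bounded continuous function on $\Omega$, and let $c-\tfrac12\nabla\cdot\vec b\ge c_0>0$ on $\Omega$. Write $c_{\max}=\sup_\Omega|c|$ and $\|\vec b\|_{0,\infty}=\sup_\Omega|\vec b|$. Let $\rho>0$ and let $\alpha_*,\gamma_*,s^*,c_I,\mu_1,\mu_2$ be arbitrary positive constants. Consider conforming meshes $\tau_h$ of $\Omega$ into finitely many polygonal/polyhedral elements $T$ with set of edges/faces $\varepsilon_h$, $h_T=\operatorname{diam}T$, $h_e=\operatorname{diam}e$, $h=\max_T h_T$, such that (Z1) $h_e\ge\rho h_T$ for every edge/face $e\subset\partial T$; (Z2) every $T$ is star-shaped with respect to all points of a ball of radius $\ge\rho h_T$; (Z3) if $d=3$, every face $e$ is star-shaped with respect to all points of a disk (in its plane) of radius $\ge\rho h_e$. For $m\ge 0$ let $H^m(\tau_h)=\{v\in L^2(\Omega): v|_T\in H^m(T)\ \forall T\}$.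 Let $H^{1,nc}(\tau_h;k)$ be the space of $v\in H^1(\tau_h)$ such that $\int_e [|v|]\cdot n_e\,q\,ds=0$ for all $q\in\mathbb P^{k-1}(e)$ and all $e\in\varepsilon_h$, where $[|v|]=v^+n_e^++v^-n_e^-$ on interior and $[|v|]=v\,n_e$ on boundary edges/faces. Let $V_h^k$ be the space of $v\in H^{1,nc}(\tau_h;k)$ with, for every $T$, $\Delta v\in\mathbb P^{k-2}(T)$ and $\partial v/\partial\mathbf n\in\mathbb P^{k-1}(e)$ on each $e\subset\partial T$ (in the weak sense; $\mathbb P^{-1}=\{0\}$). For $\epsilon>0$ and positive numbers $(\delta_T)_{T\in\tau_h}$ put $$A^T(w,v)=\int_T\epsilon\nabla w\cdot\nabla v+\tfrac12\Big[\int_T(\vec b\cdot\nabla w)v-\int_T(\vec b\cdot\nabla v)w-\int_T(\nabla\cdot\vec b)wv\Big]+\int_T c\,wv+\int_T(-\epsilon\Delta w+\vec b\cdot\nabla w+cw)\,\delta_T\,\vec b\cdot\nabla v ,$$ $$|||v|||=\Big(\sum_{T}\big\{\epsilon|v|_{1,T}^2+c_0\|v\|_{0,T}^2+\delta_T\|\vec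 b\cdot\nabla v\|_{0,T}^2\big\}\Big)^{1/2},\qquad \eta_T=\epsilon+h_T^2+\frac{h_T^2}{\delta_T}+\delta_T+\frac{h_T^2}{\epsilon}.$$ For $C_\Pi>0$ and $u\in H^{k+1}(\tau_h)$, a family $u_\Pi$ of polynomials $u_\Pi|_T\in\mathbb P^k(T)$ is called a $C_\Pi$-approximation of $u$ if for every $T\in\tau_h$ $$\|u-u_\Pi\|_{0,T}+h_T|u-u_\Pi|_{1,T}\le C_\Pi h_T^{k+1}|u|_{k+1,T}.$$ Then: (i) There is $C_\Pi>0$ such that for every mesh satisfying (Z1)–(Z3), every $u\in H^{k+1}(\tau_h)$ has a $C_\Pi$-approximation. (ii) For every $C_\Pi>0$ there is $C>0$, independent of the mesh, of $\epsilon$, of the $\delta_T$, and of $u$, $u_\Pi$ and $\delta$, such that for every mesh satisfying (Z1)–(Z3), every $\epsilon>0$, all $\delta_T$ with $$0<\delta_T\le\min\Big\{\frac{c_0\min\{s^*,\gamma_*\}}{4c_{\max}^2},\ \frac{h_T^2\alpha_*}{2\epsilon\mu_1^2},\ \min\Big\{1,\frac1{c_I}\Big\}\frac{c_0\min\{s^*,\gamma_*\}h_T^2}{4\|\vec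 b\|_{0,\infty}^2\mu_2^2}\Big\}$$ (a bound with vanishing denominator being void), every $u\in H^{k+1}(\tau_h)$, every $C_\Pi$-approximation $u_\Pi$ of $u$ and every $\delta\in V_h^k$, $$\Big|\sum_{T\in\tau_h}A^T(u_\Pi-u,\delta)\Big|\le C\,h^k\Big(\sum_{T\in\tau_h}\eta_T|u|_{k+1,T}^2\Big)^{1/2}|||\delta|||.$$ -/

import Mathlib

open MeasureTheory Topology
open scoped ContDiff

noncomputable section

namespace NCVEM

/-- `ℝ^d` with the Euclidean norm. -/
abbrev E (d : ℕ) : Type := EuclideanSpace ℝ (Fin d)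

/-- The `i`-th coordinate vector. -/
def ei {d : ℕ} (i : Fin d) : E d := EuclideanSpace.single i 1

/-! ### Polynomials -/

/-- `ℙ^r`: real polynomials in `d` variables of degree at most `r`; `ℙ^r = {0}` for `r < 0`. -/
def Poly (d : ℕ) (r : ℤ) : Set (MvPolynomial (Fin d) ℝ) :=
  {p | p = 0 ∨ (p.totalDegree : ℤ) ≤ r}

/-- The polynomial function of `p`. -/
def pval {d : ℕ} (p : MvPolynomial (Fin d) ℝ) (x : E d) : ℝ :=
  MvPolynomial.eval (fun i => x i) p

/-! ### Weak derivatives and Sobolev spaces on an open set `T` -/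

/-- `g` is the weak derivative `∂_{s 0} ⋯ ∂_{s (n-1)} u` on the open set `T`. -/
def IsWeakDeriv {d n : ℕ} (T : Set (E d)) (s : Fin n → Fin d) (u g : E d → ℝ) : Prop :=
  ∀ φ : E d → ℝ, ContDiff ℝ ∞ φ → HasCompactSupport φ → tsupport φ ⊆ T →
    ∫ x in T, u x * iteratedFDeriv ℝ n φ x (fun j => ei (s j)) = (-1) ^ n * ∫ x in T, g x * φ x

/-- `u` has a weak derivative `∂_s u` in `L²(T)`. -/
def HasL2WeakDeriv {d n : ℕ} (T : Set (E d)) (s : Fin n → Fin d) (u : E d → ℝ) : Prop :=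
  ∃ g : E d → ℝ, MemLp g 2 (volume.restrict T) ∧ IsWeakDeriv T s u g

open Classical in
/-- The weak derivative `∂_s u` in `L²(T)` (unique up to a null set; `0` if there is none). -/
def weakDeriv {d n : ℕ} (T : Set (E d)) (s : Fin n → Fin d) (u : E d → ℝ) : E d → ℝ :=
  if h : HasL2WeakDeriv T s u then h.choose else 0

/-- `u ∈ H^m(T)`. -/
def MemH {d : ℕ} (m : ℕ) (T : Set (E d)) (u : E d → ℝ) : Prop :=
  MemLp u 2 (volume.restrict T) ∧
    ∀ n : ℕ, n ≤ m → ∀ s : Fin n → Fin d, HasL2WeakDeriv T s u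

/-- `‖u‖_{0,T}`. -/
def normL2 {d : ℕ} (T : Set (E d)) (u : E d → ℝ) : ℝ := √(∫ x in T, u x ^ 2)

/-- `|u|_{m,T}`: the `L²(T)` norm of the full tensor of weak derivatives of order `m`. -/
def seminormH {d : ℕ} (m : ℕ) (T : Set (E d)) (u : E d → ℝ) : ℝ :=
  √(∑ s : Fin m → Fin d, ∫ x in T, weakDeriv T s u x ^ 2)

/-- The weak gradient of `u` on `T`. -/
def wgrad {d : ℕ} (T : Set (E d)) (u : E d → ℝ) (x : E d) : E d :=
  ∑ i : Fin d, weakDeriv T ![i] u x • ei i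

/-- The weak Laplacian of `u` on `T`. -/
def wlap {d : ℕ} (T : Set (E d)) (u : E d → ℝ) (x : E d) : ℝ :=
  ∑ i : Fin d, weakDeriv T ![i, i] u x

/-- The classical divergence of a vector field. -/
def dvg {d : ℕ} (b : E d → E d) (x : E d) : ℝ := ∑ i : Fin d, fderiv ℝ b x (ei i) i

/-- The supremum of `‖f‖` over `Ω`. -/
def supNorm {d : ℕ} {F : Type*} [Norm F] (Ω : Set (E d)) (f : E d → F) : ℝ := ⨆ x : Ω, ‖f x‖

/-! ### Polygonal / polyhedral domains and meshes -/

/-- A bounded polygonal (`d = 2`) or polyhedral (`d = 3`) domain: a nonempty bounded connected open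
set without slits whose boundary lies in finitely many hyperplanes. -/
structure IsPolytopalDomain {d : ℕ} (Ω : Set (E d)) : Prop where
  isOpen : IsOpen Ω
  bounded : Bornology.IsBounded Ω
  connected : IsConnected Ω
  no_slit : interior (closure Ω) = Ω
  flat : ∃ A : Finset (AffineSubspace ℝ (E d)),
    (∀ H ∈ A, Module.finrank ℝ H.direction = d - 1) ∧ frontier Ω ⊆ ⋃ H ∈ A, (H : Set (E d))

/-- A flat `(d-1)`-dimensional face: for `d = 2` a nondegenerate closed segment, for `d = 3` a closed
planar polygon (the relative boundary lies in finitely many subspaces of dimension `d - 2`). -/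
structure IsFlatFace {d : ℕ} (e : Set (E d)) : Prop where
  isClosed : IsClosed e
  bounded : Bornology.IsBounded e
  dim : Module.finrank ℝ (affineSpan ℝ e).direction = d - 1
  connected : IsConnected (intrinsicInterior ℝ e)
  regular : closure (intrinsicInterior ℝ e) = e
  flat : ∃ A : Finset (AffineSubspace ℝ (E d)),
    (∀ H ∈ A, Module.finrank ℝ H.direction = d - 2) ∧ intrinsicFrontier ℝ e ⊆ ⋃ H ∈ A, (H : Set (E d))

/-- A conforming polytopal mesh `τ_h` of `Ω`: finitely many disjoint open elements whose closures
cover `closure Ω`, and the finite set `ε_h` of edges/faces. The faces of an element `T` are the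
members of `ε_h` contained in `frontier T`, and they fill up `frontier T`. As usual for virtual
elements, an edge of an element may be subdivided into several collinear edges. -/
structure PolyMesh {d : ℕ} (Ω : Set (E d)) where
  elems : Finset (Set (E d))
  faces : Finset (Set (E d))
  elem_poly : ∀ T ∈ elems, IsPolytopalDomain T
  elem_subset : ∀ T ∈ elems, T ⊆ Ω
  elem_disjoint : ∀ T ∈ elems, ∀ T' ∈ elems, T ≠ T' → Disjoint T T'
  cover : closure Ω = ⋃ T ∈ elems, closure T
  face_flat : ∀ e ∈ faces, IsFlatFace e
  face_elem : ∀ e ∈ faces, ∃ T ∈ elems, e ⊆ frontier T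
  elem_frontier : ∀ T ∈ elems, frontier T = ⋃ e ∈ faces, ⋃ _ : e ⊆ frontier T, e
  face_conforming : ∀ e ∈ faces, ∀ e' ∈ faces, e ≠ e' → Disjoint (intrinsicInterior ℝ e) e'

variable {d : ℕ} {Ω : Set (E d)}

open Classical in
/-- The edges/faces of the element `T`. -/
def PolyMesh.facesOf (M : PolyMesh Ω) (T : Set (E d)) : Finset (Set (E d)) :=
  M.faces.filter fun e => e ⊆ frontier T

/-- The mesh size `h = max_T h_T`. -/
def PolyMesh.size (M : PolyMesh Ω) : ℝ := ⨆ T : M.elems, Metric.diam (T : Set (E d))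

/-- The regularity assumptions (Z1), (Z2), (Z3) with constant `ρ`. -/
structure PolyMesh.Regular (M : PolyMesh Ω) (ρ : ℝ) : Prop where
  z1 : ∀ T ∈ M.elems, ∀ e ∈ M.facesOf T, ρ * Metric.diam T ≤ Metric.diam e
  z2 : ∀ T ∈ M.elems, ∃ (x : E d) (r : ℝ), ρ * Metric.diam T ≤ r ∧
    ∀ y ∈ Metric.ball x r, StarConvex ℝ y T
  z3 : d = 3 → ∀ e ∈ M.faces, ∃ (x : E d) (r : ℝ), x ∈ affineSpan ℝ e ∧ ρ * Metric.diam e ≤ r ∧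
    ∀ y ∈ Metric.ball x r, y ∈ affineSpan ℝ e → StarConvex ℝ y e

/-- `u` belongs to the broken Sobolev space `H^m(τ_h)`. -/
def PolyMesh.MemH (M : PolyMesh Ω) (m : ℕ) (u : E d → ℝ) : Prop :=
  MemLp u 2 (volume.restrict Ω) ∧ ∀ T ∈ M.elems, NCVEM.MemH m T u

/-! ### Normals, traces and the nonconforming virtual element space -/

/-- `n` is the unit normal on the face `e` of `T` pointing out of `T`. -/
def IsOutwardNormal (T e : Set (E d)) (n : E d) : Prop :=
  ‖n‖ = 1 ∧ (∀ y ∈ (affineSpan ℝ e).direction, inner ℝ y n = 0) ∧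
    ∀ x ∈ intrinsicInterior ℝ e, ∀ᶠ t : ℝ in 𝓝[>] 0, x - t • n ∈ T ∧ x + t • n ∉ closure T

open Classical in
/-- The outward unit normal on the face `e` of `T`. -/
def outNormal (T e : Set (E d)) : E d :=
  if h : ∃ n, IsOutwardNormal T e n then h.choose else 0

/-- The surface (`(d-1)`-dimensional) measure on the face `e`. -/
def faceMeasure (e : Set (E d)) : Measure (E d) := (μHE[d - 1] : Measure (E d)).restrict e

/-- `t` is the `L²` trace on `∂T` of `v ∈ H¹(T)`, characterised through Green's formula. -/
def PolyMesh.IsTrace (M : PolyMesh Ω) (T : Set (E d)) (v t : E d → ℝ) : Prop :=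
  (∀ e ∈ M.facesOf T, MemLp t 2 (faceMeasure e)) ∧
  ∀ Φ : E d → E d, ContDiff ℝ ∞ Φ →
    ∫ x in T, (v x * dvg Φ x + inner ℝ (wgrad T v x) (Φ x)) =
      ∑ e ∈ M.facesOf T, ∫ x, t x * inner ℝ (Φ x) (outNormal T e) ∂(faceMeasure e)

/-- `v ∈ H^{1,nc}(τ_h; k)`: `v ∈ H¹(τ_h)`, and the moments up to order `k - 1` of the jump
`[|v|] = v⁺ n⁺ + v⁻ n⁻` on each interior edge/face, and of `v n` on each boundary edge/face,
vanish (in the direction of the normal). Here `t T` is the trace of `v` on `∂T`. -/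
def PolyMesh.MemHnc (M : PolyMesh Ω) (k : ℕ) (v : E d → ℝ) : Prop :=
  M.MemH 1 v ∧ ∃ t : Set (E d) → E d → ℝ, (∀ T ∈ M.elems, M.IsTrace T v (t T)) ∧
    (∀ T ∈ M.elems, ∀ T' ∈ M.elems, T ≠ T' → ∀ e ∈ M.facesOf T, e ∈ M.facesOf T' →
      ∀ q ∈ Poly d ((k : ℤ) - 1),
        ∫ x, inner ℝ (t T x • outNormal T e + t T' x • outNormal T' e) (outNormal T e) * pval q x
          ∂(faceMeasure e) = 0) ∧
    (∀ T ∈ M.elems, ∀ e ∈ M.facesOf T, e ⊆ frontier Ω → ∀ q ∈ Poly d ((k : ℤ) - 1),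
        ∫ x, inner ℝ (t T x • outNormal T e) (outNormal T e) * pval q x ∂(faceMeasure e) = 0)

/-- The local space `V_h^k(T)`: `v ∈ H¹(T)` with `Δv = f ∈ ℙ^{k-2}(T)` and `∂v/∂n = g e ∈ ℙ^{k-1}(e)`
on each edge/face `e` of `T`, in the weak (variational) sense. -/
def PolyMesh.MemVloc (M : PolyMesh Ω) (k : ℕ) (T : Set (E d)) (v : E d → ℝ) : Prop :=
  NCVEM.MemH 1 T v ∧ ∃ f ∈ Poly d ((k : ℤ) - 2), ∃ g : Set (E d) → MvPolynomial (Fin d) ℝ,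
    (∀ e ∈ M.facesOf T, g e ∈ Poly d ((k : ℤ) - 1)) ∧
    ∀ w : E d → ℝ, ContDiff ℝ ∞ w →
      (∫ x in T, inner ℝ (wgrad T v x) (gradient w x)) + ∫ x in T, pval f x * w x =
        ∑ e ∈ M.facesOf T, ∫ x, pval (g e) x * w x ∂(faceMeasure e)

/-- The global nonconforming virtual element space `V_h^k`. -/
def PolyMesh.MemV (M : PolyMesh Ω) (k : ℕ) (v : E d → ℝ) : Prop :=
  M.MemHnc k v ∧ ∀ T ∈ M.elems, M.MemVloc k T v

/-! ### Bilinear form, norm, control parameter -/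

/-- `b^T(u, v)`. -/
def bT (b : E d → E d) (T : Set (E d)) (u v : E d → ℝ) : ℝ :=
  (1 / 2) * ((∫ x in T, inner ℝ (b x) (wgrad T u x) * v x)
    - (∫ x in T, inner ℝ (b x) (wgrad T v x) * u x)
    - ∫ x in T, dvg b x * u x * v x)

/-- `b^{T,stab}(u, v)`. -/
def bTstab (ε : ℝ) (b : E d → E d) (c : E d → ℝ) (δT : ℝ) (T : Set (E d)) (u v : E d → ℝ) : ℝ :=
  ∫ x in T, (-ε * wlap T u x + inner ℝ (b x) (wgrad T u x) + c x * u x) *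
    (δT * inner ℝ (b x) (wgrad T v x))

/-- The elemental form `A^T(u, v)`, `δT` being the control parameter of the element. -/
def AT (ε : ℝ) (b : E d → E d) (c : E d → ℝ) (δT : ℝ) (T : Set (E d)) (u v : E d → ℝ) : ℝ :=
  (∫ x in T, ε * inner ℝ (wgrad T u x) (wgrad T v x)) + bT b T u v
    + (∫ x in T, c x * u x * v x) + bTstab ε b c δT T u v

/-- The norm `|||v|||`. -/
def PolyMesh.tnorm (M : PolyMesh Ω) (ε c0 : ℝ) (b : E d → E d) (δT : Set (E d) → ℝ)
    (v : E d → ℝ) : ℝ :=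
  √(∑ T ∈ M.elems, (ε * seminormH 1 T v ^ 2 + c0 * normL2 T v ^ 2
    + δT T * normL2 T (fun x => inner ℝ (b x) (wgrad T v x)) ^ 2))

/-- The condition on the control parameter: `δ_T > 0` and `δ_T` is at most each of
`c₀ min{s*, γ_*} / (4 c_max²)`, `h_T² α_* / (2 ε μ₁²)` and
`min{1, 1/c_I} c₀ min{s*, γ_*} h_T² / (4 ‖b‖² μ₂²)`. The bounds are multiplied out, so that a bound
with a vanishing denominator (`c = 0` or `b = 0`) is void. -/
def PolyMesh.ControlParam (M : PolyMesh Ω) (ε c0 : ℝ) (b : E d → E d) (c : E d → ℝ)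
    (αs γs ss cI μ₁ μ₂ : ℝ) (δT : Set (E d) → ℝ) : Prop :=
  ∀ T ∈ M.elems, 0 < δT T ∧
    δT T * (4 * supNorm Ω c ^ 2) ≤ c0 * min ss γs ∧
    δT T * (2 * ε * μ₁ ^ 2) ≤ Metric.diam T ^ 2 * αs ∧
    δT T * (4 * supNorm Ω b ^ 2 * μ₂ ^ 2) ≤
      min 1 (1 / cI) * (c0 * min ss γs) * Metric.diam T ^ 2

/-- `up` is an elementwise polynomial approximation of `u` of degree `k` with
`‖u - u_Π‖_{0,T} + h_T |u - u_Π|_{1,T} ≤ C h_T^{k+1} |u|_{k+1,T}` for every element `T`. -/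
def PolyMesh.IsPolyApprox (M : PolyMesh Ω) (k : ℕ) (C : ℝ) (u : E d → ℝ)
    (up : Set (E d) → MvPolynomial (Fin d) ℝ) : Prop :=
  ∀ T ∈ M.elems, up T ∈ Poly d k ∧
    normL2 T (fun x => u x - pval (up T) x)
      + Metric.diam T * seminormH 1 T (fun x => u x - pval (up T) x) ≤
        C * Metric.diam T ^ (k + 1) * seminormH (k + 1) T u

/-- The weight `η = ε + h_T² + h_T²/δ_T + δ_T + h_T²/ε`. -/
def eta (ε δT hT : ℝ) : ℝ := ε + hT ^ 2 + hT ^ 2 / δT + δT + hT ^ 2 / ε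

end NCVEM

end

/-! The estimate is local. On an element T put w = u_Π - u, H = h_T and Y = H^k |u|_{k+1,T}. Every
form is treated inside its element without integration by parts, so no jump terms arise:
Cauchy–Schwarz on each integral (`abs_AT_le`) leaves products of ‖w‖, |w|_1, ‖Δw‖ with the three
ingredients of |||δ|||. The approximation hypothesis gives ‖w‖ ≲ H Y and |w|_1 ≲ Y. It says nothing
about Δw, and the missing bound H ‖Δw‖ ≲ Y (`exists_normL2_wlap_le`) is the analytic core. It comes
from a second polynomial q that approximates u in all derivatives (`bramble_hilbert`): in Δw = Δ(u_Π
- q) - Δ(u - q) the first term is controlled by `inverse_inequality`, the second by the choice of q.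
The same q proves (i).

The constants may depend on the shape of T only through ρ, so both tools are proved with explicit
constants rather than by compactness.

`poincare`: for T star-shaped with respect to a ball B, the difference v(x) - v(y) with x in T and y
in B is an integral of the gradient along a segment inside T. Squaring, integrating over T × B, and
substituting in x or in y according to the position on the segment bounds the double integral by the
gradient norm; a vanishing mean over B turns this into a bound on ‖v‖. Weak derivatives are reached
by mollifying and applying Fatou's lemma. Iterating the inequality on u - q, where q matches the
means over B of all derivatives up to order k, gives `bramble_hilbert`.

`inverse_inequality`: on a line, a polynomial of degree at most k is determined by k + 1 values, so
a second derivative at x is a fixed linear combination of values at points contracted into B. A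
change of variables bounds the L² norm of each such value.

Last, the powers of ε, δ_T and H are balanced (`consistency_algebra`). The upper bounds on δ_T give
‖b‖ √δ_T ≲ H, √ε √δ_T ≲ H and c_max √δ_T ≲ 1, while √ε, H and H / √δ_T are all at most √η_T. Each
product is then ≲ √η_T Y |||δ|||_T, and a discrete Cauchy–Schwarz inequality sums over the mesh. -/

noncomputable section

namespace NCVEM

/-! ### Iterated partial derivatives of smooth functions -/

/-- The classical derivative `∂_{s 0} ⋯ ∂_{s (n-1)} f`. -/
def partialD {d n : ℕ} (s : Fin n → Fin d) (f : E d → ℝ) (x : E d) : ℝ :=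
  iteratedFDeriv ℝ n f x (fun j => ei (s j))

section PartialD

variable {d n : ℕ}

lemma partialD_zero (s : Fin 0 → Fin d) (f : E d → ℝ) : partialD s f = f := by
  ext x; simp [partialD]

lemma partialD_one (i : Fin d) (f : E d → ℝ) :
    partialD ![i] f = fun x => fderiv ℝ f x (ei i) := by
  ext x; simp [partialD, iteratedFDeriv_one_apply]

lemma contDiff_partialD (s : Fin n → Fin d) {f : E d → ℝ} (hf : ContDiff ℝ ∞ f) :
    ContDiff ℝ ∞ (partialD s f) := by
  have h : ContDiff ℝ ∞ (iteratedFDeriv ℝ n f) :=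
    hf.iteratedFDeriv_right (m := ∞) (by exact_mod_cast le_top)
  exact (ContinuousMultilinearMap.apply ℝ (fun _ : Fin n => E d) ℝ
    (fun j => ei (s j))).contDiff.comp h

lemma contDiff_fderiv_apply (i : Fin d) {f : E d → ℝ} (hf : ContDiff ℝ ∞ f) :
    ContDiff ℝ ∞ (fun x => fderiv ℝ f x (ei i)) := by
  rw [← partialD_one]; exact contDiff_partialD _ hf

lemma partialD_cons (i : Fin d) (s : Fin n → Fin d) {f : E d → ℝ} (hf : ContDiff ℝ ∞ f) :
    partialD (Fin.cons i s) f = fun x => fderiv ℝ (partialD s f) x (ei i) := by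
  ext x
  have h : DifferentiableAt ℝ (iteratedFDeriv ℝ n f) x :=
    ((hf.iteratedFDeriv_right (m := ∞) (by exact_mod_cast le_top)).differentiable
      (by simp)).differentiableAt
  have h2 : fderiv ℝ (partialD s f) x
      = (ContinuousMultilinearMap.apply ℝ (fun _ : Fin n => E d) ℝ (fun j => ei (s j))).comp
        (fderiv ℝ (iteratedFDeriv ℝ n f) x) :=
    ((ContinuousMultilinearMap.apply ℝ (fun _ : Fin n => E d) ℝ
      (fun j => ei (s j))).hasFDerivAt.comp x h.hasFDerivAt).fderiv
  rw [h2, partialD, iteratedFDeriv_succ_apply_left]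
  rfl

lemma partialD_snoc (s : Fin n → Fin d) (i : Fin d) {f : E d → ℝ} (hf : ContDiff ℝ ∞ f) :
    partialD (Fin.snoc s i : Fin (n + 1) → Fin d) f = partialD s (fun x => fderiv ℝ f x (ei i)) := by
  ext x
  rw [partialD, iteratedFDeriv_succ_apply_right, partialD]
  have h : (fun x => fderiv ℝ f x (ei i)) =
      (ContinuousLinearMap.apply ℝ ℝ (ei i)) ∘ (fun x => fderiv ℝ f x) := rfl
  have h2 : ContDiff ℝ ∞ (fun x => fderiv ℝ f x) := hf.fderiv_right (by simp)
  rw [h, ContinuousLinearMap.iteratedFDeriv_comp_left _ h2.contDiffAt (by exact_mod_cast le_top)]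
  simp only [Fin.snoc_last, ContinuousLinearMap.compContinuousMultilinearMap_coe,
    Function.comp_apply, ContinuousLinearMap.apply_apply]
  congr 2
  ext j
  simp [Fin.init]

lemma fderiv_apply_comm (i j : Fin d) {f : E d → ℝ} (hf : ContDiff ℝ ∞ f) :
    (fun x => fderiv ℝ (fun y => fderiv ℝ f y (ei i)) x (ei j)) =
      fun x => fderiv ℝ (fun y => fderiv ℝ f y (ei j)) x (ei i) := by
  ext x
  have h2 : DifferentiableAt ℝ (fderiv ℝ f) x :=
    ((hf.fderiv_right (m := ∞) (by simp)).differentiable (by simp)).differentiableAt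
  have h := (hf.contDiffAt (x := x)).isSymmSndFDerivAt
    (by simpa using (WithTop.coe_le_coe.2 (le_top : (2 : ℕ∞) ≤ ⊤)))
  rw [fderiv_clm_apply h2 (by fun_prop), fderiv_clm_apply h2 (by fun_prop)]
  simpa using h (ei j) (ei i)

/-- A smooth function bundled with its smoothness. -/
abbrev Smooth (d : ℕ) : Type := {f : E d → ℝ // ContDiff ℝ ∞ f}

/-- The partial derivative on smooth functions. -/
def Smooth.deriv (i : Fin d) (f : Smooth d) : Smooth d :=
  ⟨fun x => fderiv ℝ f.1 x (ei i), contDiff_fderiv_apply i f.2⟩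

/-- Symmetry of the second derivative, stated so that invariance of a fold under list permutations
yields symmetry in every order. -/
instance : LeftCommutative (Smooth.deriv (d := d)) :=
  ⟨fun i j f => Subtype.ext (fderiv_apply_comm j i f.2)⟩

lemma partialD_eq_foldr (s : Fin n → Fin d) (f : Smooth d) :
    partialD s f.1 = ((List.ofFn s).foldr Smooth.deriv f).1 := by
  induction n with
  | zero => simp [partialD_zero]
  | succ n ih =>
    rw [← Fin.cons_self_tail s, partialD_cons _ _ f.2, ih]
    simp [Smooth.deriv, List.ofFn_succ, Fin.tail_def]

lemma partialD_comp_perm (s : Fin n → Fin d) (σ : Equiv.Perm (Fin n)) {f : E d → ℝ}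
    (hf : ContDiff ℝ ∞ f) : partialD (s ∘ σ) f = partialD s f := by
  have h1 := partialD_eq_foldr (s ∘ σ) ⟨f, hf⟩
  have h2 := partialD_eq_foldr s ⟨f, hf⟩
  rw [(Equiv.Perm.ofFn_comp_perm σ s).foldr_eq] at h1
  exact h1.trans h2.symm

lemma partialD_snoc_eq_cons (s : Fin n → Fin d) (i : Fin d) {f : E d → ℝ} (hf : ContDiff ℝ ∞ f) :
    partialD (Fin.snoc s i : Fin (n + 1) → Fin d) f =
      partialD (Fin.cons i s : Fin (n + 1) → Fin d) f := by
  -- Appending and prepending an index differ by a cyclic rotation.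
  rw [← partialD_comp_perm (Fin.cons i s : Fin (n + 1) → Fin d) (finRotate (n + 1)) hf,
    Fin.snoc_eq_cons_rotate]
  rfl

lemma tsupport_partialD_subset (s : Fin n → Fin d) (f : E d → ℝ) :
    tsupport (partialD s f) ⊆ tsupport f := by
  refine (closure_mono fun x hx => ?_).trans (tsupport_iteratedFDeriv_subset (𝕜 := ℝ) n)
  intro h
  exact hx (by simp [partialD, h])

lemma hasCompactSupport_partialD (s : Fin n → Fin d) {f : E d → ℝ} (hf : HasCompactSupport f) :
    HasCompactSupport (partialD s f) :=
  hf.of_isClosed_subset (isClosed_tsupport _) (tsupport_partialD_subset s f)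

lemma partialD_add (s : Fin n → Fin d) {f g : E d → ℝ} (hf : ContDiff ℝ ∞ f)
    (hg : ContDiff ℝ ∞ g) :
    partialD s (fun x => f x + g x) = fun x => partialD s f x + partialD s g x := by
  ext x
  have := iteratedFDeriv_add_apply (𝕜 := ℝ) (i := n) (f := f) (g := g) (x := x)
    (hf.contDiffAt.of_le (by exact_mod_cast le_top)) (hg.contDiffAt.of_le (by exact_mod_cast le_top))
  change iteratedFDeriv ℝ n (f + g) x _ = _
  rw [this]; rfl

lemma partialD_const_of_succ {s : Fin n → Fin d} {f : E d → ℝ} (hf : ContDiff ℝ ∞ f) {a : ℝ}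
    (h : ∀ x, partialD s f x = a) (i : Fin d) (x : E d) : partialD (Fin.cons i s) f x = 0 := by
  rw [partialD_cons i s hf, show partialD s f = fun _ => a from funext h]
  simp

end PartialD

/-! ### Weak derivatives -/

section Weak

variable {d n : ℕ} {T : Set (E d)}

lemma integrable_mul_test {u φ : E d → ℝ} (hu : MemLp u 2 (volume.restrict T))
    (hφ : Continuous φ) (hc : HasCompactSupport φ) :
    Integrable (fun x => u x * φ x) (volume.restrict T) :=
  hu.integrable_mul (q := 2) (hφ.memLp_of_hasCompactSupport hc)

lemma isWeakDeriv_iff {s : Fin n → Fin d} {u g : E d → ℝ} : IsWeakDeriv T s u g ↔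
    ∀ φ : E d → ℝ, ContDiff ℝ ∞ φ → HasCompactSupport φ → tsupport φ ⊆ T →
      ∫ x in T, u x * partialD s φ x = (-1) ^ n * ∫ x in T, g x * φ x := Iff.rfl

/-- Fundamental lemma of the calculus of variations. It makes the arbitrary choice inside
`weakDeriv` harmless. -/
lemma IsWeakDeriv.ae_eq (hT : IsOpen T) {s : Fin n → Fin d} {u g g' : E d → ℝ}
    (hg : MemLp g 2 (volume.restrict T)) (hg' : MemLp g' 2 (volume.restrict T))
    (h : IsWeakDeriv T s u g) (h' : IsWeakDeriv T s u g') : g =ᵐ[volume.restrict T] g' := by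
  have hl : LocallyIntegrableOn (fun x => g x - g' x) T volume := by
    have := (hg.sub hg').locallyIntegrable (by norm_num)
    exact locallyIntegrableOn_of_locallyIntegrable_restrict this
  have := hT.ae_eq_zero_of_integral_contDiff_smul_eq_zero hl (fun φ h1 h2 h3 => by
    have e : ∫ x, φ x • (g x - g' x) = ∫ x in T, φ x • (g x - g' x) :=
      (setIntegral_eq_integral_of_forall_compl_eq_zero fun x hx => by
        rw [image_eq_zero_of_notMem_tsupport fun hh => hx (h3 hh), zero_smul]).symm
    rw [e]
    have h4 := (h φ h1 h2 h3).symm.trans (h' φ h1 h2 h3)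
    have h5 := mul_left_cancel₀ (by simp) h4
    calc ∫ x in T, φ x • (g x - g' x) = ∫ x in T, (g x * φ x - g' x * φ x) := by
          congr 1; ext x; simp; ring
      _ = 0 := by
          rw [integral_sub (integrable_mul_test hg h1.continuous h2)
            (integrable_mul_test hg' h1.continuous h2), h5, sub_self])
  rw [Filter.EventuallyEq, ae_restrict_iff' hT.measurableSet]
  filter_upwards [this] with x hx hxT
  linarith [hx hxT]

lemma memLp_weakDeriv {s : Fin n → Fin d} {u : E d → ℝ} (h : HasL2WeakDeriv T s u) :
    MemLp (weakDeriv T s u) 2 (volume.restrict T) := by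
  rw [weakDeriv, dif_pos h]; exact h.choose_spec.1

lemma isWeakDeriv_weakDeriv {s : Fin n → Fin d} {u : E d → ℝ} (h : HasL2WeakDeriv T s u) :
    IsWeakDeriv T s u (weakDeriv T s u) := by
  rw [weakDeriv, dif_pos h]; exact h.choose_spec.2

lemma IsWeakDeriv.weakDeriv_ae_eq (hT : IsOpen T) {s : Fin n → Fin d} {u g : E d → ℝ}
    (hg : MemLp g 2 (volume.restrict T)) (h : IsWeakDeriv T s u g) :
    weakDeriv T s u =ᵐ[volume.restrict T] g :=
  IsWeakDeriv.ae_eq hT (memLp_weakDeriv ⟨g, hg, h⟩) hg (isWeakDeriv_weakDeriv ⟨g, hg, h⟩) h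

lemma isWeakDeriv_zero (s : Fin 0 → Fin d) (u : E d → ℝ) : IsWeakDeriv T s u u := by
  rw [isWeakDeriv_iff]; intro φ _ _ _; simp [partialD_zero]

lemma IsWeakDeriv.sub {s : Fin n → Fin d} {u v g g' : E d → ℝ}
    (hu : MemLp u 2 (volume.restrict T)) (hv : MemLp v 2 (volume.restrict T))
    (hg : MemLp g 2 (volume.restrict T)) (hg' : MemLp g' 2 (volume.restrict T))
    (h : IsWeakDeriv T s u g) (h' : IsWeakDeriv T s v g') :
    IsWeakDeriv T s (fun x => u x - v x) (fun x => g x - g' x) := by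
  rw [isWeakDeriv_iff] at *
  intro φ h1 h2 h3
  have hp := (contDiff_partialD s h1).continuous
  have hc := hasCompactSupport_partialD s h2
  simp only [sub_mul]
  rw [integral_sub (integrable_mul_test hu hp hc) (integrable_mul_test hv hp hc),
    integral_sub (integrable_mul_test hg h1.continuous h2)
      (integrable_mul_test hg' h1.continuous h2), h φ h1 h2 h3, h' φ h1 h2 h3]
  ring

lemma integral_mul_fderiv_test {u φ : E d → ℝ} (hu : ContDiff ℝ ∞ u) (hφ : ContDiff ℝ ∞ φ)
    (hc : HasCompactSupport φ) (i : Fin d) :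
    ∫ x, u x * fderiv ℝ φ x (ei i) = - ∫ x, fderiv ℝ u x (ei i) * φ x := by
  have hc' : HasCompactSupport (fun x => fderiv ℝ φ x (ei i)) := by
    rw [← partialD_one]; exact hasCompactSupport_partialD _ hc
  have c1 := (contDiff_fderiv_apply i hφ).continuous
  have c2 := (contDiff_fderiv_apply i hu).continuous
  refine integral_mul_fderiv_eq_neg_fderiv_mul_of_integrable ?_ ?_ ?_ ?_ ?_
  · exact (c2.mul hφ.continuous).integrable_of_hasCompactSupport hc.mul_left
  · exact (hu.continuous.mul c1).integrable_of_hasCompactSupport hc'.mul_left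
  · exact (hu.continuous.mul hφ.continuous).integrable_of_hasCompactSupport hc.mul_left
  · exact fun x _ => (hu.differentiable (by simp)).differentiableAt
  · exact fun x _ => (hφ.differentiable (by simp)).differentiableAt

lemma integral_mul_partialD {u φ : E d → ℝ} (hu : ContDiff ℝ ∞ u) (hφ : ContDiff ℝ ∞ φ)
    (hc : HasCompactSupport φ) (s : Fin n → Fin d) :
    ∫ x, u x * partialD s φ x = (-1) ^ n * ∫ x, partialD s u x * φ x := by
  induction n generalizing u with
  | zero => simp [partialD_zero]
  | succ n ih =>
    -- The outermost derivative of φ is moved to u, where it becomes the innermost one; symmetry of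
    -- the derivatives puts it back in front.
    rw [← Fin.cons_self_tail s, partialD_cons _ _ hφ,
      integral_mul_fderiv_test hu (contDiff_partialD _ hφ) (hasCompactSupport_partialD _ hc),
      ih (contDiff_fderiv_apply _ hu), ← partialD_snoc_eq_cons _ _ hu, partialD_snoc _ _ hu]
    ring

lemma isWeakDeriv_of_contDiff (s : Fin n → Fin d) {u : E d → ℝ} (hu : ContDiff ℝ ∞ u) :
    IsWeakDeriv T s u (partialD s u) := by
  rw [isWeakDeriv_iff]
  intro φ h1 h2 h3
  rw [setIntegral_eq_integral_of_forall_compl_eq_zero (fun x hx => by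
      rw [image_eq_zero_of_notMem_tsupport fun hh => hx (h3 (tsupport_partialD_subset s φ hh)),
        mul_zero]),
    setIntegral_eq_integral_of_forall_compl_eq_zero (fun x hx => by
      rw [image_eq_zero_of_notMem_tsupport fun hh => hx (h3 hh), mul_zero])]
  exact integral_mul_partialD hu h1 h2 s

/-- Use ∂_i φ as a test function for g: the appended index acts first on φ, so no commutation is
needed and the factor (-1)^n cancels. -/
lemma IsWeakDeriv.of_snoc {s : Fin n → Fin d} {i : Fin d} {u g g' : E d → ℝ}
    (h : IsWeakDeriv T s u g) (h' : IsWeakDeriv T (Fin.snoc s i : Fin (n + 1) → Fin d) u g') :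
    IsWeakDeriv T ![i] g g' := by
  rw [isWeakDeriv_iff] at *
  intro φ h1 h2 h3
  have e1 := h' φ h1 h2 h3
  have hs : tsupport (partialD ![i] φ) ⊆ T := (tsupport_partialD_subset _ _).trans h3
  have e2 := h (partialD ![i] φ) (contDiff_partialD _ h1) (hasCompactSupport_partialD _ h2) hs
  rw [partialD_snoc _ _ h1, ← partialD_one, e2, pow_succ, mul_assoc] at e1
  have := mul_left_cancel₀ (by simp) e1
  simpa using this

lemma IsWeakDeriv.comp_perm {s : Fin n → Fin d} {u g : E d → ℝ} (h : IsWeakDeriv T s u g)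
    (σ : Equiv.Perm (Fin n)) : IsWeakDeriv T (s ∘ σ) u g := by
  rw [isWeakDeriv_iff] at *
  intro φ h1 h2 h3
  rw [partialD_comp_perm s σ h1]
  exact h φ h1 h2 h3

lemma memLp_of_continuous (hT : Bornology.IsBounded T) (hTm : MeasurableSet T) {f : E d → ℝ}
    (hf : Continuous f) : MemLp f 2 (volume.restrict T) := by
  obtain ⟨C, hC⟩ := (hT.isCompact_closure).exists_bound_of_continuousOn hf.continuousOn
  have : IsFiniteMeasure (volume.restrict T) := ⟨by simpa using hT.measure_lt_top⟩
  refine MemLp.of_bound hf.aestronglyMeasurable C ?_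
  filter_upwards [ae_restrict_mem hTm] with x hx using hC x (subset_closure hx)

end Weak

/-! ### The Poincaré inequality on sets that are star-shaped with respect to a ball -/

section SmoothPoincare

variable {d : ℕ}

/-- Nonnegativity of the variance. -/
lemma sq_integral_le {α : Type*} [MeasurableSpace α] {μ : Measure α} [IsProbabilityMeasure μ]
    {X : α → ℝ} (hX : MemLp X 2 μ) : (∫ x, X x ∂μ) ^ 2 ≤ ∫ x, X x ^ 2 ∂μ := by
  have h := ProbabilityTheory.variance_nonneg X μ
  rw [ProbabilityTheory.variance_eq_sub hX] at h
  simpa using h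

lemma eq_sum_smul_ei (v : E d) : v = ∑ i, v i • ei i := by
  simpa [ei] using ((EuclideanSpace.basisFun (Fin d) ℝ).sum_repr v).symm

lemma apply_sq_le (L : E d →L[ℝ] ℝ) (v : E d) : L v ^ 2 ≤ ‖v‖ ^ 2 * ∑ i, L (ei i) ^ 2 := by
  conv_lhs => rw [eq_sum_smul_ei v]
  rw [map_sum, EuclideanSpace.real_norm_sq_eq]
  simp only [map_smul, smul_eq_mul]
  exact Finset.sum_mul_sq_le_sq_mul_sq _ _ _

lemma lintegral_comp_add_smul {G : E d → ENNReal} (hG : Measurable G) (a : E d) {t : ℝ}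
    (ht : t ≠ 0) :
    ∫⁻ x, G (a + t • x) = ENNReal.ofReal |(t ^ d)⁻¹| * ∫⁻ x, G x := by
  have h1 : ∫⁻ x, G (a + t • x) = ∫⁻ z, G (a + z) ∂(Measure.map (fun x : E d => t • x) volume) := by
    exact (lintegral_map (f := fun z => G (a + z)) (hG.comp (measurable_const_add a))
      (measurable_const_smul t)).symm
  rw [h1, Measure.map_addHaar_smul _ ht, lintegral_smul_measure, lintegral_add_left_eq_self]
  simp

lemma ofReal_abs_inv_pow_le {t : ℝ} (ht : 1 / 2 ≤ t) :
    ENNReal.ofReal |(t ^ d)⁻¹| ≤ 2 ^ d := by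
  have h : |(t ^ d)⁻¹| ≤ 2 ^ d := by
    rw [abs_of_nonneg (by positivity), ← inv_pow]
    refine pow_le_pow_left₀ (by positivity) ?_ _
    rw [inv_le_comm₀ (by linarith) (by norm_num)]
    linarith
  calc ENNReal.ofReal |(t ^ d)⁻¹| ≤ ENNReal.ofReal (2 ^ d) := ENNReal.ofReal_le_ofReal h
    _ = 2 ^ d := by rw [ENNReal.ofReal_pow (by norm_num)]; simp

/-- The point y + t (x - y) scales with t in x and with 1 - t in y. One of the two is at least 1/2,
and substituting in that variable costs a Jacobian of at most 2^d; the other variable contributes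
its volume. This removes the singularity at the ends of the segment. -/
lemma lintegral_lintegral_segment_le {G : E d → ENNReal} (hG : Measurable G) (A B : Set (E d))
    (t : ℝ) :
    ∫⁻ x in A, ∫⁻ y in B, G (y + t • (x - y)) ≤
      2 ^ d * (volume A + volume B) * ∫⁻ z, G z := by
  rcases le_total (1 / 2) t with ht | ht
  · have hm : Measurable (Function.uncurry fun x y : E d => G (y + t • (x - y))) :=
      hG.comp (by fun_prop)
    rw [lintegral_lintegral_swap hm.aemeasurable]
    calc ∫⁻ y in B, ∫⁻ x in A, G (y + t • (x - y))
        ≤ ∫⁻ y in B, 2 ^ d * ∫⁻ z, G z := by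
          refine lintegral_mono fun y => ?_
          refine (setLIntegral_le_lintegral _ _).trans ?_
          have : ∀ x : E d, y + t • (x - y) = (y - t • y) + t • x := fun x => by
            rw [smul_sub]; abel
          simp only [this]
          rw [lintegral_comp_add_smul hG _ (by linarith)]
          gcongr
          exact ofReal_abs_inv_pow_le ht
      _ = 2 ^ d * volume B * ∫⁻ z, G z := by
          rw [lintegral_const, Measure.restrict_apply_univ]; ring
      _ ≤ _ := by gcongr; exact le_add_self
  · calc ∫⁻ x in A, ∫⁻ y in B, G (y + t • (x - y))
        ≤ ∫⁻ x in A, 2 ^ d * ∫⁻ z, G z := by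
          refine lintegral_mono fun x => ?_
          refine (setLIntegral_le_lintegral _ _).trans ?_
          have : ∀ y : E d, y + t • (x - y) = t • x + (1 - t) • y := fun y => by
            rw [smul_sub, sub_smul, one_smul]; abel
          simp only [this]
          rw [lintegral_comp_add_smul hG _ (by linarith)]
          gcongr
          exact ofReal_abs_inv_pow_le (by linarith)
      _ = 2 ^ d * volume A * ∫⁻ z, G z := by
          rw [lintegral_const, Measure.restrict_apply_univ]; ring
      _ ≤ _ := by gcongr; exact le_self_add

/-- The squared Euclidean norm of the classical gradient. -/
def gradSq (F : E d → ℝ) (x : E d) : ℝ := ∑ i, fderiv ℝ F x (ei i) ^ 2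

lemma continuous_gradSq {F : E d → ℝ} (hF : ContDiff ℝ 1 F) : Continuous (gradSq F) := by
  have := hF.continuous_fderiv (by norm_num)
  unfold gradSq
  fun_prop

/-- Fundamental theorem of calculus on the segment, then Jensen on [0, 1] and Cauchy–Schwarz for the
directional derivative. -/
lemma sq_sub_le_lintegral_segment {F : E d → ℝ} (hF : ContDiff ℝ 1 F) (x y : E d) :
    ENNReal.ofReal ((F x - F y) ^ 2) ≤ ENNReal.ofReal (‖x - y‖ ^ 2) *
      ∫⁻ t in Set.Icc (0 : ℝ) 1, ENNReal.ofReal (gradSq F (y + t • (x - y))) := by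
  have hc := hF.continuous_fderiv (by norm_num)
  have hcs := continuous_gradSq hF
  set f' : ℝ → ℝ := fun t => fderiv ℝ F (y + t • (x - y)) (x - y) with hf'
  have hf'c : Continuous f' := by fun_prop
  have hder : ∀ t : ℝ, HasDerivAt (fun t : ℝ => F (y + t • (x - y))) (f' t) t := fun t => by
    have h1 : HasDerivAt (fun t : ℝ => y + t • (x - y)) (x - y) t := by
      simpa using ((hasDerivAt_id t).smul_const (x - y)).const_add y
    exact ((hF.differentiable (by norm_num)) _).hasFDerivAt.comp_hasDerivAt t h1
  have hftc := intervalIntegral.integral_eq_sub_of_hasDerivAt (a := 0) (b := 1)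
    (fun t _ => hder t) (hf'c.intervalIntegrable _ _)
  rw [intervalIntegral.integral_of_le zero_le_one, ← integral_Icc_eq_integral_Ioc] at hftc
  simp only [one_smul, zero_smul, add_zero, add_sub_cancel] at hftc
  have hprob : IsProbabilityMeasure (volume.restrict (Set.Icc (0 : ℝ) 1)) := ⟨by simp⟩
  have hmem : MemLp f' 2 (volume.restrict (Set.Icc (0 : ℝ) 1)) := by
    obtain ⟨C, hC⟩ := isCompact_Icc.exists_bound_of_continuousOn (hf'c.continuousOn (s := Set.Icc 0 1))
    exact MemLp.of_bound hf'c.aestronglyMeasurable C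
      ((ae_restrict_mem measurableSet_Icc).mono fun t ht => hC t ht)
  have hint : Integrable (fun t => ‖x - y‖ ^ 2 * gradSq F (y + t • (x - y)))
      (volume.restrict (Set.Icc (0 : ℝ) 1)) :=
    (Continuous.integrableOn_Icc (by fun_prop))
  rw [← hftc]
  calc ENNReal.ofReal ((∫ t in Set.Icc (0 : ℝ) 1, f' t) ^ 2)
      ≤ ENNReal.ofReal (∫ t in Set.Icc (0 : ℝ) 1, ‖x - y‖ ^ 2 * gradSq F (y + t • (x - y))) := by
        refine ENNReal.ofReal_le_ofReal ((sq_integral_le hmem).trans ?_)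
        exact integral_mono hmem.integrable_sq hint fun t => apply_sq_le _ _
    _ = ∫⁻ t in Set.Icc (0 : ℝ) 1, ENNReal.ofReal (‖x - y‖ ^ 2 * gradSq F (y + t • (x - y))) := by
        refine ofReal_integral_eq_lintegral_ofReal hint (ae_of_all _ fun t => ?_)
        exact mul_nonneg (sq_nonneg _) (Finset.sum_nonneg fun i _ => sq_nonneg _)
    _ = _ := by
        simp only [ENNReal.ofReal_mul (sq_nonneg ‖x - y‖)]
        rw [lintegral_const_mul _ (by fun_prop)]

/-- The segment formula, Tonelli to bring the segment parameter outside, and the substitution bound.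
Extending the squared gradient by zero outside A loses nothing because the segments stay in A. -/
lemma lintegral_sq_sub_le_of_contDiff {F : E d → ℝ} (hF : ContDiff ℝ 1 F) {A B : Set (E d)}
    (hA : MeasurableSet A) (hB : MeasurableSet B)
    (hstar : ∀ x ∈ A, ∀ y ∈ B, ∀ t ∈ Set.Icc (0 : ℝ) 1, y + t • (x - y) ∈ A) {H : ℝ}
    (hH : ∀ x ∈ A, ∀ y ∈ B, ‖x - y‖ ≤ H) :
    ∫⁻ x in A, ∫⁻ y in B, ENNReal.ofReal ((F x - F y) ^ 2) ≤
      ENNReal.ofReal (H ^ 2) * (2 ^ d * (volume A + volume B)) *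
        ∫⁻ z in A, ENNReal.ofReal (gradSq F z) := by
  set G : E d → ENNReal := A.indicator fun z => ENNReal.ofReal (gradSq F z) with hG
  have hGm : Measurable G :=
    ((continuous_gradSq hF).measurable.ennreal_ofReal).indicator hA
  have hm3 : Measurable fun p : (E d × E d) × ℝ => G (p.1.2 + p.2 • (p.1.1 - p.1.2)) :=
    hGm.comp (by fun_prop)
  have hm2 : Measurable fun p : E d × E d =>
      ∫⁻ t in Set.Icc (0 : ℝ) 1, G (p.2 + t • (p.1 - p.2)) := hm3.lintegral_prod_right'
  calc ∫⁻ x in A, ∫⁻ y in B, ENNReal.ofReal ((F x - F y) ^ 2)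
      ≤ ∫⁻ x in A, ∫⁻ y in B, ENNReal.ofReal (H ^ 2) *
          ∫⁻ t in Set.Icc (0 : ℝ) 1, G (y + t • (x - y)) := by
        refine setLIntegral_mono' hA fun x hx => setLIntegral_mono' hB fun y hy => ?_
        refine (sq_sub_le_lintegral_segment hF x y).trans ?_
        refine mul_le_mul' (ENNReal.ofReal_le_ofReal (pow_le_pow_left₀ (norm_nonneg _)
          (hH x hx y hy) 2)) (setLIntegral_mono' measurableSet_Icc fun t ht => ?_)
        rw [hG, Set.indicator_of_mem (hstar x hx y hy t ht)]
    _ = ENNReal.ofReal (H ^ 2) * ∫⁻ x in A, ∫⁻ y in B,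
          ∫⁻ t in Set.Icc (0 : ℝ) 1, G (y + t • (x - y)) := by
        rw [← lintegral_const_mul _ hm2.lintegral_prod_right']
        refine lintegral_congr fun x => ?_
        rw [← lintegral_const_mul]
        exact hm2.comp (by fun_prop : Measurable fun y : E d => (x, y))
    _ = ENNReal.ofReal (H ^ 2) * ∫⁻ t in Set.Icc (0 : ℝ) 1, ∫⁻ x in A, ∫⁻ y in B,
          G (y + t • (x - y)) := by
        congr 1
        have h1 : ∀ x : E d, ∫⁻ y in B, ∫⁻ t in Set.Icc (0 : ℝ) 1, G (y + t • (x - y)) =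
            ∫⁻ t in Set.Icc (0 : ℝ) 1, ∫⁻ y in B, G (y + t • (x - y)) := fun x =>
          lintegral_lintegral_swap (hGm.comp (by fun_prop)).aemeasurable
        simp only [h1]
        refine lintegral_lintegral_swap (Measurable.aemeasurable ?_)
        have : Measurable fun p : (E d × ℝ) × E d => G (p.2 + p.1.2 • (p.1.1 - p.2)) :=
          hGm.comp (by fun_prop)
        exact this.lintegral_prod_right'
    _ ≤ ENNReal.ofReal (H ^ 2) * ∫⁻ _ in Set.Icc (0 : ℝ) 1,
          2 ^ d * (volume A + volume B) * ∫⁻ z, G z := by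
        gcongr
        exact lintegral_lintegral_segment_le hGm A B _
    _ = _ := by
        rw [lintegral_const, Measure.restrict_apply_univ, Real.volume_Icc, hG,
          lintegral_indicator hA]
        simp [mul_assoc]

end SmoothPoincare

/-! ### Mollification, and the double-integral estimate for weak derivatives. -/

section Mollify

variable {d : ℕ} {T : Set (E d)}

open scoped Convolution

/-- The mollification of a function by a normed smooth bump. -/
def mollify (φ : ContDiffBump (0 : E d)) (f : E d → ℝ) : E d → ℝ :=
  (φ.normed volume) ⋆[ContinuousLinearMap.lsmul ℝ ℝ, volume] f

lemma mollify_apply (φ : ContDiffBump (0 : E d)) (f : E d → ℝ) (x : E d) :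
    mollify φ f x = ∫ y, φ.normed volume (x - y) * f y := by
  rw [mollify, convolution_eq_swap]; rfl

lemma contDiff_mollify (φ : ContDiffBump (0 : E d)) {f : E d → ℝ} (hf : LocallyIntegrable f) :
    ContDiff ℝ ∞ (mollify φ f) :=
  φ.hasCompactSupport_normed.contDiff_convolution_left _ φ.contDiff_normed hf

lemma memLp_indicator (hT : IsOpen T) {v : E d → ℝ} (hv : MemLp v 2 (volume.restrict T)) :
    MemLp (T.indicator v) 2 volume :=
  (memLp_indicator_iff_restrict hT.measurableSet).2 hv

lemma fderiv_mollify_apply (φ : ContDiffBump (0 : E d)) {f : E d → ℝ} (hf : LocallyIntegrable f)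
    (x : E d) (i : Fin d) :
    fderiv ℝ (mollify φ f) x (ei i) =
      ∫ y, f y * fderiv ℝ (φ.normed volume) (x - y) (ei i) := by
  have h0 : mollify φ f = f ⋆[(ContinuousLinearMap.lsmul ℝ ℝ).flip, volume] (φ.normed volume) := by
    rw [mollify, convolution_flip]
  have hc : HasCompactSupport (φ.normed volume) := φ.hasCompactSupport_normed
  have hd : ContDiff ℝ 1 (φ.normed volume) := φ.contDiff_normed
  have h1 := hc.hasFDerivAt_convolution_right (𝕜 := ℝ) (ContinuousLinearMap.lsmul ℝ ℝ).flip hf hd x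
  rw [h0, h1.fderiv, convolution_precompR_apply _ hf (hc.fderiv ℝ) (hd.continuous_fderiv (by simp))]
  simp only [convolution, ContinuousLinearMap.flip_apply, ContinuousLinearMap.lsmul_apply,
    smul_eq_mul, mul_comm]

/-- When the ball of radius `φ.rOut` around x lies in T, the reflected and translated bump is an
admissible test function on T. -/
lemma fderiv_mollify_of_isWeakDeriv (hT : IsOpen T) (φ : ContDiffBump (0 : E d)) {v g : E d → ℝ}
    {i : Fin d} (hv : MemLp v 2 (volume.restrict T)) (h : IsWeakDeriv T ![i] v g) {x : E d}
    (hx : Metric.closedBall x φ.rOut ⊆ T) :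
    fderiv ℝ (mollify φ (T.indicator v)) x (ei i) = mollify φ (T.indicator g) x := by
  have hl := (memLp_indicator hT hv).locallyIntegrable (by norm_num)
  rw [fderiv_mollify_apply φ hl, mollify_apply]
  set ψ : E d → ℝ := φ.normed volume with hψ
  have hψc : ContDiff ℝ ∞ ψ := φ.contDiff_normed
  set χ : E d → ℝ := fun y => ψ (x - y) with hχ
  have hχc : ContDiff ℝ ∞ χ := hψc.comp (contDiff_const.sub contDiff_id)
  have hsub : tsupport χ ⊆ Metric.closedBall x φ.rOut := by
    refine closure_minimal (fun y hy => ?_) Metric.isClosed_closedBall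
    have h1 : x - y ∈ Function.support ψ := hy
    rw [hψ, ContDiffBump.support_normed_eq, mem_ball_zero_iff] at h1
    rw [Metric.mem_closedBall, dist_comm, dist_eq_norm]
    exact h1.le
  have hcs : HasCompactSupport χ :=
    (isCompact_closedBall x φ.rOut).of_isClosed_subset (isClosed_tsupport _) hsub
  have key := (isWeakDeriv_iff.1 h) χ hχc hcs (hsub.trans hx)
  -- This sign from the reflection cancels the one in the definition of a first weak derivative.
  have hder : ∀ y, partialD ![i] χ y = - fderiv ℝ ψ (x - y) (ei i) := fun y => by
    rw [partialD_one]
    have h1 : HasFDerivAt (fun y : E d => x - y) (-(ContinuousLinearMap.id ℝ (E d))) y := by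
      simpa using (hasFDerivAt_id y).const_sub x
    have h2 : HasFDerivAt χ _ y :=
      ((hψc.differentiable (by simp)) (x - y)).hasFDerivAt.comp y h1
    simp [h2.fderiv]
  simp only [hder, mul_neg, integral_neg, pow_one, neg_mul, one_mul, neg_inj] at key
  have e1 : ∀ f w : E d → ℝ, ∫ y, T.indicator f y * w y = ∫ y in T, f y * w y := fun f w => by
    rw [← integral_indicator hT.measurableSet]
    congr 1; ext y
    by_cases hy : y ∈ T <;> simp [hy]
  simp only [mul_comm (ψ _)]
  rw [e1, e1]
  exact key

/-- Jensen for the probability density given by the bump, obtained by expanding the weighted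
integral of (f - m)², with m the mollified value. -/
lemma ofReal_sq_mollify_le (φ : ContDiffBump (0 : E d)) {f : E d → ℝ} (hf : MemLp f 2 volume)
    (x : E d) : ENNReal.ofReal (mollify φ f x ^ 2) ≤
      ∫⁻ y, ENNReal.ofReal (φ.normed volume (x - y)) * ENNReal.ofReal (f y ^ 2) := by
  rw [mollify_apply]
  set ψ : E d → ℝ := fun y => φ.normed volume (x - y) with hψ
  have hψ0 : ∀ y, 0 ≤ ψ y := fun y => φ.nonneg_normed _
  have hψc : Continuous ψ := φ.continuous_normed.comp (by fun_prop)
  have hcs : HasCompactSupport ψ :=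
    φ.hasCompactSupport_normed.comp_homeomorph (Homeomorph.subLeft x)
  have hone : ∫ y, ψ y = 1 := by
    rw [hψ, integral_sub_left_eq_self (fun y => φ.normed volume y)]
    exact φ.integral_normed
  have i0 : Integrable ψ := hψc.integrable_of_hasCompactSupport hcs
  have i1 : Integrable fun y => ψ y * f y :=
    (hf.locallyIntegrable (by norm_num)).integrable_smul_left_of_hasCompactSupport hψc hcs
  have i2 : Integrable fun y => ψ y * f y ^ 2 :=
    hf.integrable_sq.locallyIntegrable.integrable_smul_left_of_hasCompactSupport hψc hcs
  set m := ∫ y, ψ y * f y with hm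
  have h : 0 ≤ ∫ y, ψ y * (f y - m) ^ 2 :=
    integral_nonneg fun y => mul_nonneg (hψ0 y) (sq_nonneg _)
  have e : ∫ y, ψ y * (f y - m) ^ 2 = (∫ y, ψ y * f y ^ 2) - 2 * m * m + m ^ 2 := by
    have : ∀ y, ψ y * (f y - m) ^ 2 = ψ y * f y ^ 2 - 2 * m * (ψ y * f y) + m ^ 2 * ψ y :=
      fun y => by ring
    have i3 : Integrable fun y => 2 * m * (ψ y * f y) := i1.const_mul _
    have i4 : Integrable fun y => ψ y * f y ^ 2 - 2 * m * (ψ y * f y) := i2.sub i3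
    simp only [this]
    rw [integral_add i4 (i0.const_mul _), integral_sub i2 i3, integral_const_mul,
      integral_const_mul, hone]
    ring
  have hle : m ^ 2 ≤ ∫ y, ψ y * f y ^ 2 := by nlinarith
  refine (ENNReal.ofReal_le_ofReal hle).trans (le_of_eq ?_)
  rw [ofReal_integral_eq_lintegral_ofReal i2
    (ae_of_all _ fun y => mul_nonneg (hψ0 y) (sq_nonneg _))]
  simp only [ENNReal.ofReal_mul (hψ0 _)]
  rfl

lemma lintegral_lintegral_sub_mul {a b : E d → ENNReal} (ha : Measurable a)
    (hb : AEMeasurable b volume) :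
    ∫⁻ x, ∫⁻ y, a (x - y) * b y = (∫⁻ x, a x) * ∫⁻ y, b y := by
  have hm : Measurable fun p : E d × E d => a (p.1 - p.2) := ha.comp (by fun_prop)
  rw [lintegral_lintegral_swap (hm.aemeasurable.mul hb.comp_snd), ← lintegral_const_mul'' _ hb]
  refine lintegral_congr fun y => ?_
  have hmy : Measurable fun x : E d => a (x - y) := ha.comp (by fun_prop)
  rw [lintegral_mul_const _ hmy, lintegral_sub_right_eq_self]

/-- Young's inequality for a kernel of mass one: integrate the pointwise Jensen bound by Tonelli. -/
lemma lintegral_sq_mollify_le (φ : ContDiffBump (0 : E d)) {f : E d → ℝ} (hf : MemLp f 2 volume) :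
    ∫⁻ x, ENNReal.ofReal (mollify φ f x ^ 2) ≤ ∫⁻ x, ENNReal.ofReal (f x ^ 2) := by
  have hψm : Continuous (φ.normed (volume : Measure (E d))) := φ.continuous_normed
  have hone : ∫⁻ x, ENNReal.ofReal (φ.normed (volume : Measure (E d)) x) = 1 := by
    rw [← ofReal_integral_eq_lintegral_ofReal φ.integrable_normed
      (ae_of_all _ fun y => φ.nonneg_normed y), φ.integral_normed, ENNReal.ofReal_one]
  have hfm : AEMeasurable (fun y => ENNReal.ofReal (f y ^ 2)) volume :=
    (hf.aestronglyMeasurable.aemeasurable.pow_const 2).ennreal_ofReal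
  have h := lintegral_lintegral_sub_mul (a := fun z => ENNReal.ofReal (φ.normed volume z))
    (ENNReal.measurable_ofReal.comp hψm.measurable) hfm
  rw [hone, one_mul] at h
  exact (lintegral_mono fun x => ofReal_sq_mollify_le φ hf x).trans h.le

/-- The points whose distance to the complement of `T` is at least `ε`. -/
def innerPart (T : Set (E d)) (ε : ℝ) : Set (E d) := (Metric.thickening ε Tᶜ)ᶜ

lemma mem_innerPart {ε : ℝ} {x : E d} : x ∈ innerPart T ε ↔ ∀ y ∉ T, ε ≤ dist x y := by
  simp [innerPart, Metric.mem_thickening_iff]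

lemma measurableSet_innerPart (ε : ℝ) : MeasurableSet (innerPart T ε) :=
  Metric.isOpen_thickening.measurableSet.compl

lemma innerPart_subset {ε : ℝ} (hε : 0 < ε) : innerPart T ε ⊆ T := fun x hx => by
  by_contra h
  have := mem_innerPart.1 hx x h
  rw [dist_self] at this
  linarith

lemma closedBall_subset_of_mem_innerPart {ε r : ℝ} (hr : r < ε) {x : E d}
    (hx : x ∈ innerPart T ε) : Metric.closedBall x r ⊆ T := fun y hy => by
  by_contra h
  have h1 := mem_innerPart.1 hx y h
  rw [Metric.mem_closedBall, dist_comm] at hy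
  linarith

/-- Shrinking T and the ball together preserves star-shapedness. If z outside T were within ε of the
point on the segment, translating the segment by the offset w would keep its ends in T and in the
large ball while passing through z. -/
lemma segment_mem_innerPart {x0 : E d} {R ε : ℝ}
    (hstar : ∀ y ∈ Metric.ball x0 R, StarConvex ℝ y T) {x y : E d} (hx : x ∈ innerPart T ε)
    (hy : y ∈ Metric.ball x0 (R - ε)) {t : ℝ} (ht : t ∈ Set.Icc (0 : ℝ) 1) :
    y + t • (x - y) ∈ innerPart T ε := by
  rw [mem_innerPart]
  intro z hz
  by_contra! h
  set w := z - (y + t • (x - y)) with hw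
  have hwn : ‖w‖ < ε := by rwa [hw, ← dist_eq_norm, dist_comm]
  have h1 : x + w ∈ T := by
    by_contra h2
    have := mem_innerPart.1 hx _ h2
    rw [dist_self_add_right] at this
    linarith
  have h2 : y + w ∈ Metric.ball x0 R := by
    rw [Metric.mem_ball, dist_eq_norm] at hy ⊢
    calc ‖y + w - x0‖ = ‖(y - x0) + w‖ := by congr 1; abel
      _ ≤ ‖y - x0‖ + ‖w‖ := norm_add_le _ _
      _ < R := by linarith
  have h3 := (hstar _ h2) h1 (a := 1 - t) (b := t) (by linarith [ht.2]) ht.1 (by ring)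
  apply hz
  convert h3 using 1
  rw [smul_add, smul_add, sub_smul, sub_smul, one_smul, one_smul]
  have : z = w + (y + t • (x - y)) := by rw [hw]; abel
  rw [this, smul_sub]
  abel

lemma eventually_mem_innerPart (hT : IsOpen T) {x : E d} (hx : x ∈ T) {ε : ℕ → ℝ}
    (hε : Filter.Tendsto ε Filter.atTop (𝓝 0)) : ∀ᶠ n in Filter.atTop, x ∈ innerPart T (ε n) := by
  obtain ⟨r, hr, hb⟩ := Metric.isOpen_iff.1 hT x hx
  filter_upwards [hε.eventually (gt_mem_nhds hr)] with n hn
  rw [mem_innerPart]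
  intro y hy
  by_contra! h
  exact hy (hb (by rw [Metric.mem_ball, dist_comm]; exact h.trans hn))

/-- A shrinking sequence of bumps. -/
def bumpSeq (d n : ℕ) : ContDiffBump (0 : E d) where
  rIn := 1 / (2 * (n + 1))
  rOut := 1 / (n + 1)
  rIn_pos := by positivity
  rIn_lt_rOut := by
    rw [one_div_lt_one_div (by positivity) (by positivity)]
    have : (0 : ℝ) ≤ n := n.cast_nonneg
    linarith

/-- The margin of two bump radii leaves strict room for the closed ball of one radius, so on the
shrunken set the gradient of the mollification is the mollified weak gradient. -/
lemma lintegral_sq_sub_mollify_le (hT : IsOpen T) {x0 : E d} {R H : ℝ}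
    (hstar : ∀ y ∈ Metric.ball x0 R, StarConvex ℝ y T)
    (hH : ∀ x ∈ T, ∀ y ∈ Metric.ball x0 R, ‖x - y‖ ≤ H) {v : E d → ℝ} {g : Fin d → E d → ℝ}
    (hv : MemLp v 2 (volume.restrict T)) (hg : ∀ i, MemLp (g i) 2 (volume.restrict T))
    (h : ∀ i, IsWeakDeriv T ![i] v (g i)) (φ : ContDiffBump (0 : E d)) :
    ∫⁻ x in innerPart T (2 * φ.rOut), ∫⁻ y in Metric.ball x0 (R - 2 * φ.rOut),
        ENNReal.ofReal ((mollify φ (T.indicator v) x - mollify φ (T.indicator v) y) ^ 2) ≤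
      ENNReal.ofReal (H ^ 2) * (2 ^ d * (volume T + volume (Metric.ball x0 R))) *
        ∑ i, ∫⁻ z in T, ENNReal.ofReal (g i z ^ 2) := by
  have hr := φ.rOut_pos
  have hl := (memLp_indicator hT hv).locallyIntegrable (by norm_num)
  have hs : Metric.ball x0 (R - 2 * φ.rOut) ⊆ Metric.ball x0 R := Metric.ball_subset_ball (by linarith)
  have hsub : innerPart T (2 * φ.rOut) ⊆ T := innerPart_subset (by linarith)
  refine (lintegral_sq_sub_le_of_contDiff ((contDiff_mollify φ hl).of_le (by simp))
    (measurableSet_innerPart _) Metric.isOpen_ball.measurableSet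
    (fun x hx y hy t ht => segment_mem_innerPart hstar hx hy ht)
    (fun x hx y hy => hH x (hsub hx) y (hs hy))).trans ?_
  refine mul_le_mul' (mul_le_mul' le_rfl (mul_le_mul' le_rfl (add_le_add (measure_mono hsub)
    (measure_mono hs)))) ?_
  calc ∫⁻ z in innerPart T (2 * φ.rOut), ENNReal.ofReal (gradSq (mollify φ (T.indicator v)) z)
      = ∫⁻ z in innerPart T (2 * φ.rOut), ∑ i, ENNReal.ofReal (mollify φ (T.indicator (g i)) z ^ 2) := by
        refine setLIntegral_congr_fun (measurableSet_innerPart _) fun z hz => ?_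
        simp only [gradSq]
        rw [ENNReal.ofReal_sum_of_nonneg fun i _ => sq_nonneg _]
        refine Finset.sum_congr rfl fun i _ => ?_
        rw [fderiv_mollify_of_isWeakDeriv hT φ hv (h i)
          (closedBall_subset_of_mem_innerPart (by linarith) hz)]
    _ ≤ ∫⁻ z, ∑ i, ENNReal.ofReal (mollify φ (T.indicator (g i)) z ^ 2) :=
        setLIntegral_le_lintegral _ _
    _ = ∑ i, ∫⁻ z, ENNReal.ofReal (mollify φ (T.indicator (g i)) z ^ 2) := by
        refine lintegral_finsetSum _ fun i _ => ?_
        have := (contDiff_mollify φ ((memLp_indicator hT (hg i)).locallyIntegrable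
          (by norm_num))).continuous
        fun_prop
    _ ≤ ∑ i, ∫⁻ z in T, ENNReal.ofReal (g i z ^ 2) := by
        refine Finset.sum_le_sum fun i _ => (lintegral_sq_mollify_le φ
          (memLp_indicator hT (hg i))).trans (le_of_eq ?_)
        rw [← lintegral_indicator hT.measurableSet]
        refine lintegral_congr fun z => ?_
        by_cases hz : z ∈ T <;> simp [hz]

/-- Moves the domains into indicators on one fixed product measure, as Fatou's lemma needs for
shrinking domains. -/
lemma setLIntegral_setLIntegral_eq {A B : Set (E d)} (hA : MeasurableSet A) (hB : MeasurableSet B)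
    {f : E d × E d → ENNReal} (hf : AEMeasurable f (volume.prod volume)) :
    ∫⁻ x in A, ∫⁻ y in B, f (x, y) = ∫⁻ p, (A ×ˢ B).indicator f p ∂(volume.prod volume) := by
  rw [lintegral_indicator (hA.prod hB), ← Measure.prod_restrict, lintegral_prod]
  rw [Measure.prod_restrict]
  exact hf.restrict

lemma lintegral_sq_sub_le (hT : IsOpen T) {x0 : E d} {R H : ℝ}
    (hstar : ∀ y ∈ Metric.ball x0 R, StarConvex ℝ y T) (hball : Metric.ball x0 R ⊆ T)
    (hH : ∀ x ∈ T, ∀ y ∈ Metric.ball x0 R, ‖x - y‖ ≤ H) {v : E d → ℝ} {g : Fin d → E d → ℝ}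
    (hv : MemLp v 2 (volume.restrict T)) (hg : ∀ i, MemLp (g i) 2 (volume.restrict T))
    (h : ∀ i, IsWeakDeriv T ![i] v (g i)) :
    ∫⁻ x in T, ∫⁻ y in Metric.ball x0 R, ENNReal.ofReal ((v x - v y) ^ 2) ≤
      ENNReal.ofReal (H ^ 2) * (2 ^ d * (volume T + volume (Metric.ball x0 R))) *
        ∑ i, ∫⁻ z in T, ENNReal.ofReal (g i z ^ 2) := by
  set V := T.indicator v with hV
  have hVm := memLp_indicator hT hv
  have hl := hVm.locallyIntegrable (by norm_num)
  have hVa : AEMeasurable V volume := hVm.aestronglyMeasurable.aemeasurable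
  set r : ℕ → ℝ := fun n => (bumpSeq d n).rOut with hr
  have hr0 : Filter.Tendsto r Filter.atTop (𝓝 0) := tendsto_one_div_add_atTop_nhds_zero_nat
  have h2r0 : Filter.Tendsto (fun n => 2 * r n) Filter.atTop (𝓝 0) := by
    simpa using hr0.const_mul 2
  set F : ℕ → E d → ℝ := fun n => mollify (bumpSeq d n) V with hF
  have hFc : ∀ n, Continuous (F n) := fun n => (contDiff_mollify _ hl).continuous
  have hconv : ∀ᵐ x : E d, Filter.Tendsto (fun n => F n x) Filter.atTop (𝓝 (V x)) := by
    -- The outer radius in `bumpSeq` is exactly twice the inner one.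
    refine ContDiffBump.ae_convolution_tendsto_right_of_locallyIntegrable (K := 2) hr0 ?_ hl
    refine Filter.Eventually.of_forall fun n => le_of_eq ?_
    simp only [bumpSeq]
    field_simp
  set f : E d × E d → ENNReal := fun p => ENNReal.ofReal ((V p.1 - V p.2) ^ 2) with hf
  set fn : ℕ → E d × E d → ENNReal := fun n =>
    (innerPart T (2 * r n) ×ˢ Metric.ball x0 (R - 2 * r n)).indicator
      fun p => ENNReal.ofReal ((F n p.1 - F n p.2) ^ 2) with hfn
  have hFm : ∀ n, Measurable fun p : E d × E d => ENNReal.ofReal ((F n p.1 - F n p.2) ^ 2) :=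
    fun n => by have := hFc n; exact ENNReal.measurable_ofReal.comp (Continuous.measurable (by fun_prop))
  have hfnm : ∀ n, Measurable (fn n) := fun n =>
    (hFm n).indicator ((measurableSet_innerPart _).prod Metric.isOpen_ball.measurableSet)
  have hfm : AEMeasurable f (volume.prod volume) :=
    ((hVa.comp_fst.sub hVa.comp_snd).pow_const 2).ennreal_ofReal
  -- T and the ball are open, so each point of the product eventually belongs to the shrunken
  -- domains, and there the mollifications converge almost everywhere.
  have hlim : ∀ᵐ p ∂(volume.prod volume : Measure (E d × E d)),
      (T ×ˢ Metric.ball x0 R).indicator f p ≤ Filter.liminf (fun n => fn n p) Filter.atTop := by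
    filter_upwards [Measure.quasiMeasurePreserving_fst.ae hconv,
      Measure.quasiMeasurePreserving_snd.ae hconv] with p h1 h2
    by_cases hp : p ∈ T ×ˢ Metric.ball x0 R
    · have ht : Filter.Tendsto (fun n => fn n p) Filter.atTop (𝓝 (f p)) := by
        have ht1 : Filter.Tendsto (fun n => ENNReal.ofReal ((F n p.1 - F n p.2) ^ 2))
            Filter.atTop (𝓝 (f p)) := ENNReal.tendsto_ofReal ((h1.sub h2).pow 2)
        refine ht1.congr' ?_
        have hb : ∀ᶠ n in Filter.atTop, p.2 ∈ Metric.ball x0 (R - 2 * r n) := by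
          have := hp.2
          rw [Metric.mem_ball] at this
          filter_upwards [h2r0.eventually (gt_mem_nhds (sub_pos.2 this))] with n hn
          rw [Metric.mem_ball]
          linarith
        filter_upwards [eventually_mem_innerPart hT hp.1 h2r0, hb] with n hn1 hn2
        have hpn : p ∈ innerPart T (2 * r n) ×ˢ Metric.ball x0 (R - 2 * r n) := ⟨hn1, hn2⟩
        exact (Set.indicator_of_mem hpn fun p => ENNReal.ofReal ((F n p.1 - F n p.2) ^ 2)).symm
      rw [ht.liminf_eq, Set.indicator_of_mem hp]
    · rw [Set.indicator_of_notMem hp]; exact zero_le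
  calc ∫⁻ x in T, ∫⁻ y in Metric.ball x0 R, ENNReal.ofReal ((v x - v y) ^ 2)
      = ∫⁻ x in T, ∫⁻ y in Metric.ball x0 R, f (x, y) := by
        refine setLIntegral_congr_fun hT.measurableSet fun x hx => ?_
        refine setLIntegral_congr_fun Metric.isOpen_ball.measurableSet fun y hy => ?_
        simp [hf, hV, hx, hball hy]
    _ = ∫⁻ p, (T ×ˢ Metric.ball x0 R).indicator f p ∂(volume.prod volume) :=
        setLIntegral_setLIntegral_eq hT.measurableSet Metric.isOpen_ball.measurableSet hfm
    _ ≤ ∫⁻ p, Filter.liminf (fun n => fn n p) Filter.atTop ∂(volume.prod volume) :=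
        lintegral_mono_ae hlim
    _ ≤ Filter.liminf (fun n => ∫⁻ p, fn n p ∂(volume.prod volume)) Filter.atTop :=
        lintegral_liminf_le hfnm
    _ ≤ _ := by
        refine Filter.liminf_le_of_le (by isBoundedDefault) fun b hb => ?_
        obtain ⟨n, hn⟩ := hb.exists
        refine hn.trans ?_
        rw [hfn, ← setLIntegral_setLIntegral_eq (measurableSet_innerPart _)
          Metric.isOpen_ball.measurableSet (hFm n).aemeasurable]
        exact lintegral_sq_sub_mollify_le hT hstar hH hv hg h (bumpSeq d n)

end Mollify

/-! ### From the double integral to the Poincaré inequality. -/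

section Poincare

variable {d : ℕ} {T : Set (E d)}

/-- Expand the square: the cross term vanishes with the mean of v, and the term in v² is
nonnegative. -/
lemma mul_sq_le_setIntegral_sq_sub {B : Set (E d)} (hB : volume B ≠ ⊤) {v : E d → ℝ}
    (hv : MemLp v 2 (volume.restrict B)) (h0 : ∫ y in B, v y = 0) (a : ℝ) :
    ENNReal.ofReal (volume.real B * a ^ 2) ≤ ∫⁻ y in B, ENNReal.ofReal ((a - v y) ^ 2) := by
  have hfin : IsFiniteMeasure (volume.restrict B) := ⟨by simpa using hB.lt_top⟩
  have i1 : Integrable v (volume.restrict B) := hv.integrable (by norm_num)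
  have i2 := hv.integrable_sq
  have i3 : Integrable (fun y => (a - v y) ^ 2) (volume.restrict B) :=
    ((memLp_const a).sub hv).integrable_sq
  rw [← ofReal_integral_eq_lintegral_ofReal i3 (ae_of_all _ fun y => sq_nonneg _)]
  refine ENNReal.ofReal_le_ofReal ?_
  have e : ∀ y, (a - v y) ^ 2 = a ^ 2 - 2 * a * v y + v y ^ 2 := fun y => by ring
  have i4 : Integrable (fun y => 2 * a * v y) (volume.restrict B) := i1.const_mul _
  have i5 : Integrable (fun y => a ^ 2 - 2 * a * v y) (volume.restrict B) :=
    (integrable_const _).sub i4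
  simp only [e]
  rw [integral_add i5 i2, integral_sub (integrable_const _) i4, integral_const_mul, h0]
  have : 0 ≤ ∫ y in B, v y ^ 2 := integral_nonneg fun y => sq_nonneg _
  simpa using this

/-- The Poincaré inequality on a set that is star-shaped with respect to a ball, for functions with
vanishing mean over the ball. -/
theorem poincare (hT : IsOpen T) {x0 : E d} {ρ H : ℝ} (hρ : 0 < ρ) (hH0 : 0 < H)
    (hstar : ∀ y ∈ Metric.ball x0 (ρ * H), StarConvex ℝ y T)
    (hball : Metric.ball x0 (ρ * H) ⊆ T) (hH : ∀ x ∈ T, ∀ y ∈ T, ‖x - y‖ ≤ H)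
    {v : E d → ℝ} {g : Fin d → E d → ℝ}
    (hv : MemLp v 2 (volume.restrict T)) (hg : ∀ i, MemLp (g i) 2 (volume.restrict T))
    (h : ∀ i, IsWeakDeriv T ![i] v (g i)) (h0 : ∫ y in Metric.ball x0 (ρ * H), v y = 0) :
    ∫ x in T, v x ^ 2 ≤ 2 ^ d * (1 + (ρ ^ d)⁻¹) * H ^ 2 * ∑ i, ∫ x in T, g i x ^ 2 := by
  set B := Metric.ball x0 (ρ * H) with hB
  have hx0 : x0 ∈ B := Metric.mem_ball_self (by positivity)
  have hTsub : T ⊆ Metric.closedBall x0 H := fun x hx => by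
    rw [Metric.mem_closedBall, dist_eq_norm]; exact hH x hx x0 (hball hx0)
  have hTfin : volume T ≠ ⊤ :=
    ((measure_mono hTsub).trans_lt (isCompact_closedBall x0 H).measure_lt_top).ne
  have hBfin : volume B ≠ ⊤ := measure_ball_lt_top.ne
  have hBpos : 0 < volume.real B :=
    ENNReal.toReal_pos (Metric.measure_ball_pos _ _ (by positivity)).ne' hBfin
  -- T lies in the closed ball of radius H about the centre of B; this makes the constant depend on
  -- the shape through ρ alone.
  have hvol : volume.real T ≤ (ρ ^ d)⁻¹ * volume.real B := by
    have h1 : volume.real B = ρ ^ d * (H ^ d * volume.real (Metric.ball (0 : E d) 1)) := by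
      rw [hB, measureReal_def, Measure.addHaar_ball_of_pos volume x0 (by positivity)]
      simp [measureReal_def, mul_pow, ENNReal.toReal_ofReal (by positivity : 0 ≤ ρ ^ d * H ^ d)]
      ring
    have h2 : volume.real (Metric.closedBall x0 H) = H ^ d * volume.real (Metric.ball (0 : E d) 1) := by
      rw [measureReal_def, Measure.addHaar_closedBall volume x0 hH0.le]
      simp [measureReal_def, ENNReal.toReal_ofReal (by positivity : 0 ≤ H ^ d)]
    rw [h1, inv_mul_cancel_left₀ (by positivity), ← h2]
    exact measureReal_mono hTsub (isCompact_closedBall x0 H).measure_lt_top.ne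
  have key := lintegral_sq_sub_le hT hstar hball (fun x hx y hy => hH x hx y (hball hy)) hv hg h
  have hvB : MemLp v 2 (volume.restrict B) := hv.mono_measure (Measure.restrict_mono hball le_rfl)
  have hl : ENNReal.ofReal (volume.real B * ∫ x in T, v x ^ 2) ≤
      ∫⁻ x in T, ∫⁻ y in B, ENNReal.ofReal ((v x - v y) ^ 2) := by
    rw [← integral_const_mul, ofReal_integral_eq_lintegral_ofReal (hv.integrable_sq.const_mul _)
      (ae_of_all _ fun y => mul_nonneg hBpos.le (sq_nonneg _))]
    exact lintegral_mono fun x => mul_sq_le_setIntegral_sq_sub hBfin hvB h0 _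
  have hg0 : ∀ i, 0 ≤ ∫ x in T, g i x ^ 2 := fun i => integral_nonneg fun y => sq_nonneg _
  have hr : ENNReal.ofReal (H ^ 2) * (2 ^ d * (volume T + volume B)) *
        ∑ i, ∫⁻ z in T, ENNReal.ofReal (g i z ^ 2) =
      ENNReal.ofReal (H ^ 2 * (2 ^ d * (volume.real T + volume.real B)) *
        ∑ i, ∫ x in T, g i x ^ 2) := by
    have h2d : ENNReal.ofReal (2 ^ d) = 2 ^ d := by
      rw [ENNReal.ofReal_pow (by norm_num), ENNReal.ofReal_ofNat]
    rw [ENNReal.ofReal_mul (by positivity), ENNReal.ofReal_mul (by positivity),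
      ENNReal.ofReal_mul (by positivity), ENNReal.ofReal_add (by positivity) (by positivity),
      ofReal_measureReal hTfin, ofReal_measureReal hBfin, h2d, ENNReal.ofReal_sum_of_nonneg fun i _ => hg0 i]
    congr 1
    refine Finset.sum_congr rfl fun i _ => ?_
    rw [ofReal_integral_eq_lintegral_ofReal (hg i).integrable_sq (ae_of_all _ fun y => sq_nonneg _)]
  have hS : 0 ≤ ∑ i, ∫ x in T, g i x ^ 2 := Finset.sum_nonneg fun i _ => hg0 i
  rw [hr] at key
  have h1 := (ENNReal.ofReal_le_ofReal_iff (by positivity)).1 (hl.trans key)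
  refine le_of_mul_le_mul_left (h1.trans ?_) hBpos
  calc H ^ 2 * (2 ^ d * (volume.real T + volume.real B)) * ∑ i, ∫ x in T, g i x ^ 2
      ≤ H ^ 2 * (2 ^ d * ((ρ ^ d)⁻¹ * volume.real B + volume.real B)) *
          ∑ i, ∫ x in T, g i x ^ 2 := by gcongr
    _ = _ := by ring

end Poincare

/-! ### Averaged Taylor-type polynomials and the Bramble–Hilbert lemma. -/

section Polynomials

variable {d : ℕ}

lemma pval_add (p q : MvPolynomial (Fin d) ℝ) : pval (p + q) = fun x => pval p x + pval q x := by
  ext x; simp [pval]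

lemma contDiff_pval (p : MvPolynomial (Fin d) ℝ) : ContDiff ℝ ∞ (pval p) := by
  induction p using MvPolynomial.induction_on with
  | C a =>
    have e : pval (MvPolynomial.C a) = fun _ : E d => a := by ext x; simp [pval]
    rw [e]; exact contDiff_const
  | add p q hp hq => rw [pval_add]; exact hp.add hq
  | mul_X p i hp =>
    have h : ContDiff ℝ ∞ fun x : E d => x i := by fun_prop
    have e : pval (p * MvPolynomial.X i) = fun x : E d => pval p x * x i := by ext x; simp [pval]
    rw [e]; exact hp.mul h

/-- The multilinear form with coefficients `c`. -/
def coeffForm {j : ℕ} (c : (Fin j → Fin d) → ℝ) :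
    ContinuousMultilinearMap ℝ (fun _ : Fin j => E d) ℝ :=
  ∑ s, c s • (ContinuousMultilinearMap.mkPiAlgebra ℝ (Fin j) ℝ).compContinuousLinearMap
    (fun i => EuclideanSpace.proj (s i))

lemma coeffForm_apply {j : ℕ} (c : (Fin j → Fin d) → ℝ) (v : Fin j → E d) :
    coeffForm c v = ∑ s, c s * ∏ i, v i (s i) := by
  simp [coeffForm]

lemma coeffForm_ei {j : ℕ} (c : (Fin j → Fin d) → ℝ) (s : Fin j → Fin d) :
    coeffForm c (fun i => ei (s i)) = c s := by
  rw [coeffForm_apply, Finset.sum_eq_single s]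
  · simp [ei]
  · intro t _ ht
    obtain ⟨i, hi⟩ := Function.ne_iff.1 ht
    rw [Finset.prod_eq_zero (Finset.mem_univ i), mul_zero]
    simp [ei, hi]
  · simp

lemma partialD_eq_zero_of_lt {j : ℕ} {f : E d → ℝ} (hf : ContDiff ℝ ∞ f)
    {c : (Fin j → Fin d) → ℝ} (h : ∀ s x, partialD s f x = c s) {n : ℕ} (hn : j < n)
    (s : Fin n → Fin d) (x : E d) : partialD s f x = 0 := by
  induction n, hn using Nat.le_induction generalizing x with
  | base => rw [← Fin.cons_self_tail s, partialD_const_of_succ hf (h _)]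
  | succ n hn ih => rw [← Fin.cons_self_tail s, partialD_const_of_succ hf (ih _)]

/-- The j-th derivative of the diagonal of a j-linear form sums the form over all j! permutations of
its arguments; for symmetric coefficients these summands agree, whence the division by j!. -/
lemma exists_polynomial_partialD_eq {j : ℕ} (c : (Fin j → Fin d) → ℝ)
    (hc : ∀ s (σ : Equiv.Perm (Fin j)), c (s ∘ σ) = c s) :
    ∃ p : MvPolynomial (Fin d) ℝ, p.totalDegree ≤ j ∧ ∀ s x, partialD s (pval p) x = c s := by
  refine ⟨∑ s, MvPolynomial.C (c s / (j.factorial : ℝ)) * ∏ i, MvPolynomial.X (s i), ?_, ?_⟩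
  · refine MvPolynomial.totalDegree_finsetSum_le fun s _ => ?_
    refine (MvPolynomial.totalDegree_mul _ _).trans ?_
    rw [MvPolynomial.totalDegree_C, zero_add]
    refine (MvPolynomial.totalDegree_finsetProd _ _).trans ?_
    simp
  · intro s x
    have e : pval (∑ s, MvPolynomial.C (c s / (j.factorial : ℝ)) * ∏ i, MvPolynomial.X (s i)) =
        fun x : E d => coeffForm (fun s => c s / (j.factorial : ℝ)) fun _ => x := by
      ext x; simp [pval, coeffForm_apply]
    rw [e, partialD, ContinuousMultilinearMap.iteratedFDeriv_comp_diagonal]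
    have : ∀ σ : Equiv.Perm (Fin j), (coeffForm (fun s => c s / (j.factorial : ℝ))
        fun i => ei (s (σ i))) = c s / (j.factorial : ℝ) := fun σ => by
      rw [← hc s σ]; exact coeffForm_ei _ (s ∘ σ)
    simp only [this]
    simp [Fintype.card_perm, mul_div_cancel₀, Nat.factorial_ne_zero]

variable {T : Set (E d)}

lemma integrableOn_weakDeriv_sub {n : ℕ} {s : Fin n → Fin d} {u : E d → ℝ}
    (h : HasL2WeakDeriv T s u) {x0 : E d} {r : ℝ} (hB : Metric.ball x0 r ⊆ T)
    (q : MvPolynomial (Fin d) ℝ) :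
    Integrable (fun x => weakDeriv T s u x - partialD s (pval q) x)
      (volume.restrict (Metric.ball x0 r)) := by
  have hfin : IsFiniteMeasure (volume.restrict (Metric.ball x0 r)) :=
    ⟨by simpa using measure_ball_lt_top⟩
  have h1 := ((memLp_weakDeriv h).mono_measure (Measure.restrict_mono hB le_rfl)).integrable
    (by norm_num)
  have h2 := (memLp_of_continuous (Metric.isBounded_ball (x := x0) (r := r))
    Metric.isOpen_ball.measurableSet (contDiff_partialD s (contDiff_pval q)).continuous).integrable
    (by norm_num)
  exact h1.sub h2

/-- The means are matched from the highest order downwards: a homogeneous correction of degree j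
fixes order j and leaves all higher orders untouched. -/
lemma exists_polynomial_mean_eq (hT : IsOpen T) {x0 : E d} {r : ℝ} (hr : 0 < r)
    (hB : Metric.ball x0 r ⊆ T) {k : ℕ} {u : E d → ℝ}
    (hu : ∀ n ≤ k, ∀ s : Fin n → Fin d, HasL2WeakDeriv T s u) :
    ∃ q : MvPolynomial (Fin d) ℝ, q.totalDegree ≤ k ∧
      (∀ n, k < n → ∀ (s : Fin n → Fin d) (x : E d), partialD s (pval q) x = 0) ∧
      ∀ n ≤ k, ∀ s : Fin n → Fin d,
        ∫ x in Metric.ball x0 r, (weakDeriv T s u x - partialD s (pval q) x) = 0 := by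
  set B := Metric.ball x0 r with hBdef
  have hfin : volume B ≠ ⊤ := measure_ball_lt_top.ne
  have hpos : 0 < volume.real B :=
    ENNReal.toReal_pos (Metric.measure_ball_pos _ _ hr).ne' hfin
  have hfinm : IsFiniteMeasure (volume.restrict B) := ⟨by simpa using hfin.lt_top⟩
  -- After m corrections the m highest orders, k + 1 - m to k, are matched.
  suffices H : ∀ m ≤ k + 1, ∃ q : MvPolynomial (Fin d) ℝ, q.totalDegree ≤ k ∧
      (∀ n, k < n → ∀ (s : Fin n → Fin d) (x : E d), partialD s (pval q) x = 0) ∧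
      ∀ n ≤ k, k + 1 ≤ n + m → ∀ s : Fin n → Fin d,
        ∫ x in B, (weakDeriv T s u x - partialD s (pval q) x) = 0 by
    obtain ⟨q, h1, h2, h3⟩ := H (k + 1) le_rfl
    exact ⟨q, h1, h2, fun n hn => h3 n hn (by omega)⟩
  intro m
  induction m with
  | zero =>
    intro _
    refine ⟨0, by simp, fun n hn s x => ?_, fun n hn hn' => by omega⟩
    have : pval (0 : MvPolynomial (Fin d) ℝ) = fun _ : E d => (0 : ℝ) := by ext; simp [pval]
    rw [this, partialD]
    simp
  | succ m ih =>
    intro hm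
    obtain ⟨q, h1, h2, h3⟩ := ih (by omega)
    obtain ⟨j, rfl⟩ : ∃ j, k = j + m := ⟨k - m, by omega⟩
    set c : (Fin j → Fin d) → ℝ := fun s =>
      (volume.real B)⁻¹ * ∫ x in B, (weakDeriv T s u x - partialD s (pval q) x) with hcdef
    -- Weak derivatives inherit symmetry, almost everywhere, from the derivatives of test functions.
    have hc : ∀ s (σ : Equiv.Perm (Fin j)), c (s ∘ σ) = c s := fun s σ => by
      have hw := hu j (by omega) s
      have hae : weakDeriv T (s ∘ σ) u =ᵐ[volume.restrict B] weakDeriv T s u :=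
        (((isWeakDeriv_weakDeriv hw).comp_perm σ).weakDeriv_ae_eq hT
          (memLp_weakDeriv hw)).filter_mono (ae_mono (Measure.restrict_mono hB le_rfl))
      simp only [hcdef]
      congr 1
      refine integral_congr_ae ?_
      filter_upwards [hae] with x hx
      rw [hx, partialD_comp_perm s σ (contDiff_pval q)]
    obtain ⟨p, hp1, hp2⟩ := exists_polynomial_partialD_eq c hc
    have hadd : ∀ {n : ℕ} (s : Fin n → Fin d) (x : E d), partialD s (pval (q + p)) x =
        partialD s (pval q) x + partialD s (pval p) x := fun s x => by
      rw [pval_add, partialD_add s (contDiff_pval q) (contDiff_pval p)]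
    have hp3 : ∀ n, j < n → ∀ (s : Fin n → Fin d) (x : E d), partialD s (pval p) x = 0 :=
      fun n hn s x => partialD_eq_zero_of_lt (contDiff_pval p) hp2 hn s x
    refine ⟨q + p, (MvPolynomial.totalDegree_add _ _).trans (max_le h1 (by omega)),
      fun n hn s x => ?_, fun n hn hn' s => ?_⟩
    · rw [hadd, h2 n hn, hp3 n (by omega), add_zero]
    · rcases Nat.lt_or_ge j n with hj | hj
      · simp only [hadd, hp3 n hj, add_zero]
        exact h3 n hn (by omega) s
      · obtain rfl : n = j := by omega
        have e : ∀ x, weakDeriv T s u x - partialD s (pval (q + p)) x =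
            (weakDeriv T s u x - partialD s (pval q) x) - c s := fun x => by
          rw [hadd, hp2]; ring
        simp only [e]
        rw [integral_sub (integrableOn_weakDeriv_sub (hu n hn s) hB q) (integrable_const _)]
        simp only [integral_const, measureReal_restrict_apply_univ, smul_eq_mul, hcdef]
        rw [mul_inv_cancel_left₀ hpos.ne', sub_self]

/-- The squared `L²` norm of the difference of the derivatives of order `n` of `u` and of `q`. -/
def jetDist {d : ℕ} (n : ℕ) (T : Set (E d)) (u : E d → ℝ) (q : MvPolynomial (Fin d) ℝ) : ℝ :=
  ∑ s : Fin n → Fin d, ∫ x in T, (weakDeriv T s u x - partialD s (pval q) x) ^ 2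

lemma sq_seminormH (m : ℕ) (u : E d → ℝ) :
    seminormH m T u ^ 2 = ∑ s : Fin m → Fin d, ∫ x in T, weakDeriv T s u x ^ 2 :=
  Real.sq_sqrt (Finset.sum_nonneg fun _ _ => integral_nonneg fun _ => sq_nonneg _)

lemma memLp_weakDeriv_sub (hTb : Bornology.IsBounded T) (hT : IsOpen T) {n : ℕ} {s : Fin n → Fin d}
    {u : E d → ℝ} (h : HasL2WeakDeriv T s u) (q : MvPolynomial (Fin d) ℝ) :
    MemLp (fun x => weakDeriv T s u x - partialD s (pval q) x) 2 (volume.restrict T) :=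
  (memLp_weakDeriv h).sub (memLp_of_continuous hTb hT.measurableSet
    (contDiff_partialD s (contDiff_pval q)).continuous)

lemma isWeakDeriv_sub_pval (hTb : Bornology.IsBounded T) (hT : IsOpen T) {n : ℕ} {s : Fin n → Fin d}
    {u : E d → ℝ} (hu : MemLp u 2 (volume.restrict T)) (h : HasL2WeakDeriv T s u)
    (q : MvPolynomial (Fin d) ℝ) :
    IsWeakDeriv T s (fun x => u x - pval q x)
      (fun x => weakDeriv T s u x - partialD s (pval q) x) :=
  IsWeakDeriv.sub hu (memLp_of_continuous hTb hT.measurableSet (contDiff_pval q).continuous)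
    (memLp_weakDeriv h) (memLp_of_continuous hTb hT.measurableSet
      (contDiff_partialD s (contDiff_pval q)).continuous)
    (isWeakDeriv_weakDeriv h) (isWeakDeriv_of_contDiff s (contDiff_pval q))

/-- The Bramble–Hilbert lemma on a set that is star-shaped with respect to a ball. -/
theorem bramble_hilbert (hT : IsOpen T) {x0 : E d} {ρ H : ℝ} (hρ : 0 < ρ) (hH0 : 0 < H)
    (hstar : ∀ y ∈ Metric.ball x0 (ρ * H), StarConvex ℝ y T)
    (hball : Metric.ball x0 (ρ * H) ⊆ T) (hH : ∀ x ∈ T, ∀ y ∈ T, ‖x - y‖ ≤ H) {k : ℕ}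
    {u : E d → ℝ} (hu : MemH (k + 1) T u) :
    ∃ q : MvPolynomial (Fin d) ℝ, q.totalDegree ≤ k ∧ ∀ n m, n + m = k + 1 →
      jetDist n T u q ≤ (2 ^ d * (1 + (ρ ^ d)⁻¹) * H ^ 2) ^ m * seminormH (k + 1) T u ^ 2 := by
  have hTb : Bornology.IsBounded T := Metric.isBounded_iff.2 ⟨H, fun x hx y hy => by
    rw [dist_eq_norm]; exact hH x hx y hy⟩
  obtain ⟨q, h1, h2, h3⟩ := exists_polynomial_mean_eq hT (mul_pos hρ hH0) hball
    (fun n hn s => hu.2 n (hn.trans (Nat.le_succ k)) s)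
  refine ⟨q, h1, fun n m => ?_⟩
  -- Each use of Poincaré trades a factor C for one more derivative, passing from (n, m + 1) to (n +
  -- 1, m), until order k + 1, where the derivatives of q vanish.
  induction m generalizing n with
  | zero =>
    intro hn
    obtain rfl : n = k + 1 := hn
    simp [jetDist, sq_seminormH, h2 (k + 1) (Nat.lt_succ_self k)]
  | succ m ih =>
    intro hn
    have hnk : n ≤ k := by omega
    set C := 2 ^ d * (1 + (ρ ^ d)⁻¹) * H ^ 2 with hC
    have hC0 : 0 ≤ C := by positivity
    have step : jetDist n T u q ≤ C * jetDist (n + 1) T u q := by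
      -- The last index is split off to match `IsWeakDeriv.of_snoc`.
      have e : jetDist (n + 1) T u q = ∑ s : Fin n → Fin d, ∑ i : Fin d,
          ∫ x in T, (weakDeriv T (Fin.snoc s i : Fin (n + 1) → Fin d) u x -
            partialD (Fin.snoc s i : Fin (n + 1) → Fin d) (pval q) x) ^ 2 := by
        rw [jetDist, ← (Fin.snocEquiv fun _ : Fin (n + 1) => Fin d).sum_comp, Fintype.sum_prod_type,
          Finset.sum_comm]
        rfl
      rw [e, Finset.mul_sum]
      refine Finset.sum_le_sum fun s _ => ?_
      refine poincare hT hρ hH0 hstar hball hH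
        (memLp_weakDeriv_sub hTb hT (hu.2 n (by omega) s) q)
        (fun i => memLp_weakDeriv_sub hTb hT (hu.2 (n + 1) (by omega) _) q)
        (fun i => ?_) (h3 n hnk s)
      exact (isWeakDeriv_sub_pval hTb hT hu.1 (hu.2 n (by omega) s) q).of_snoc
        (isWeakDeriv_sub_pval hTb hT hu.1 (hu.2 (n + 1) (by omega) _) q)
    calc jetDist n T u q ≤ C * jetDist (n + 1) T u q := step
      _ ≤ C * (C ^ m * seminormH (k + 1) T u ^ 2) :=
          mul_le_mul_of_nonneg_left (ih (n + 1) (by omega)) hC0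
      _ = _ := by ring

end Polynomials

/-! ### An inverse inequality for polynomials -/

section Inverse

variable {d : ℕ}

/-- Equidistant nodes in `(0, σ]`. -/
def node (k : ℕ) (σ : ℝ) (l : Fin (k + 1)) : ℝ := σ * ((l + 1 : ℕ) : ℝ) / ((k + 1 : ℕ) : ℝ)

lemma node_pos {k : ℕ} {σ : ℝ} (hσ : 0 < σ) (l : Fin (k + 1)) : 0 < node k σ l := by
  unfold node; positivity

lemma node_le {k : ℕ} {σ : ℝ} (hσ : 0 < σ) (l : Fin (k + 1)) : node k σ l ≤ σ := by
  unfold node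
  rw [div_le_iff₀ (by positivity)]
  have : ((l + 1 : ℕ) : ℝ) ≤ ((k + 1 : ℕ) : ℝ) := by exact_mod_cast l.2
  gcongr

lemma node_injective {k : ℕ} {σ : ℝ} (hσ : 0 < σ) : Function.Injective (node k σ) := by
  intro l m h
  unfold node at h
  have h1 := mul_left_cancel₀ hσ.ne' ((div_left_inj' (by positivity)).1 h)
  have h2 : (l + 1 : ℕ) = m + 1 := by exact_mod_cast h1
  exact Fin.ext (by omega)

/-- Lagrange interpolation; the weights are the values of L on the Lagrange basis and do not depend
on the polynomial. -/
lemma exists_weights (k : ℕ) {σ : ℝ} (hσ : 0 < σ) (L : Polynomial ℝ →ₗ[ℝ] ℝ) :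
    ∃ a : Fin (k + 1) → ℝ, ∀ P : Polynomial ℝ, P.natDegree ≤ k →
      L P = ∑ l, a l * P.eval (node k σ l) := by
  refine ⟨fun l => L (Lagrange.basis Finset.univ (node k σ) l), fun P hP => ?_⟩
  have h := Lagrange.eq_interpolate (s := Finset.univ) (v := node k σ)
    ((node_injective hσ).injOn) (f := P) (by
      rw [Finset.card_univ, Fintype.card_fin]
      exact (Polynomial.degree_le_of_natDegree_le hP).trans_lt (by exact_mod_cast Nat.lt_succ_self k))
  conv_lhs => rw [h, Lagrange.interpolate_apply]
  rw [map_sum]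
  refine Finset.sum_congr rfl fun l _ => ?_
  rw [← Polynomial.smul_eq_C_mul, map_smul, smul_eq_mul, mul_comm]

/-- The restriction of a polynomial to the line `t ↦ x + t v`. -/
def linePoly (p : MvPolynomial (Fin d) ℝ) (x v : E d) : Polynomial ℝ :=
  MvPolynomial.aeval (fun i => Polynomial.C (x i) + Polynomial.C (v i) * Polynomial.X) p

lemma eval_linePoly (p : MvPolynomial (Fin d) ℝ) (x v : E d) (t : ℝ) :
    (linePoly p x v).eval t = pval p (x + t • v) := by
  induction p using MvPolynomial.induction_on with
  | C a => simp [linePoly, pval]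
  | add p q hp hq =>
    simp only [linePoly, pval] at hp hq ⊢
    rw [map_add, Polynomial.eval_add, hp, hq, map_add]
  | mul_X p i hp =>
    simp only [linePoly, pval] at hp ⊢
    rw [map_mul, Polynomial.eval_mul, hp, map_mul, MvPolynomial.aeval_X, MvPolynomial.eval_X]
    simp only [Polynomial.eval_add, Polynomial.eval_mul, Polynomial.eval_C, Polynomial.eval_X,
      PiLp.add_apply, PiLp.smul_apply, smul_eq_mul, mul_comm (v i) t]

lemma natDegree_linePoly_le {p : MvPolynomial (Fin d) ℝ} {k : ℕ} (hp : p.totalDegree ≤ k)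
    (x v : E d) : (linePoly p x v).natDegree ≤ k := by
  have := MvPolynomial.aeval_natDegree_le (n := 1) p hp
    (fun i => Polynomial.C (x i) + Polynomial.C (v i) * Polynomial.X) (fun i => by compute_degree)
  simpa [linePoly] using this

lemma hasDerivAt_comp_line {f : E d → ℝ} (hf : ContDiff ℝ ∞ f) (x : E d) (H : ℝ) (i : Fin d)
    (t : ℝ) : HasDerivAt (fun t : ℝ => f (x + t • (H • ei i)))
      (H * partialD ![i] f (x + t • (H • ei i))) t := by
  have h1 : HasDerivAt (fun t : ℝ => x + t • (H • ei i)) (H • (ei i : E d)) t := by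
    simpa using ((hasDerivAt_id t).smul_const (H • (ei i : E d))).const_add x
  have h2 := ((hf.differentiable (by simp)) (x + t • (H • ei i))).hasFDerivAt.comp_hasDerivAt t h1
  have e : H * partialD ![i] f (x + t • (H • ei i)) =
      fderiv ℝ f (x + t • (H • ei i)) (H • ei i) := by
    rw [partialD_one, map_smul, smul_eq_mul]
  rw [e]
  exact h2

lemma eval_derivative_derivative_linePoly (p : MvPolynomial (Fin d) ℝ) (x : E d) (H : ℝ)
    (i : Fin d) : (linePoly p x (H • ei i)).derivative.derivative.eval 0 =
      H ^ 2 * partialD ![i, i] (pval p) x := by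
  have hp := contDiff_pval p
  have h1 : ∀ t, (linePoly p x (H • ei i)).derivative.eval t =
      H * partialD ![i] (pval p) (x + t • (H • ei i)) := fun t => by
    have e : (fun t => (linePoly p x (H • ei i)).eval t) =
        fun t : ℝ => pval p (x + t • (H • ei i)) := funext fun t => eval_linePoly p x _ t
    have h := (linePoly p x (H • ei i)).hasDerivAt t
    rw [e] at h
    exact h.unique (hasDerivAt_comp_line hp x H i t)
  have h := (linePoly p x (H • ei i)).derivative.hasDerivAt 0
  rw [funext h1] at h
  have h2 := h.unique ((hasDerivAt_comp_line (contDiff_partialD ![i] hp) x H i 0).const_mul H)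
  have h3 : partialD ![i, i] (pval p) = partialD ![i] (partialD ![i] (pval p)) := by
    rw [partialD_one i (partialD _ _)]
    exact partialD_cons i ![i] hp
  rw [h2, h3]
  simp
  ring

/-- Substitution under a contraction that maps T into itself. Its Jacobian is why the interpolation
nodes avoid 0. -/
lemma setLIntegral_sq_comp_le {T : Set (E d)} (hT : IsOpen T) {f : E d → ℝ} (hf : Continuous f)
    (a x0 : E d) {t : ℝ} (ht : 0 < t) (hmap : ∀ x ∈ T, a + t • (x - x0) ∈ T) :
    ∫⁻ x in T, ENNReal.ofReal (f (a + t • (x - x0)) ^ 2) ≤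
      ENNReal.ofReal (t ^ d)⁻¹ * ∫⁻ x in T, ENNReal.ofReal (f x ^ 2) := by
  set G : E d → ENNReal := T.indicator fun x => ENNReal.ofReal (f x ^ 2) with hG
  have hGm : Measurable G :=
    (ENNReal.measurable_ofReal.comp (hf.pow 2).measurable).indicator hT.measurableSet
  have e : ∀ x : E d, a + t • (x - x0) = (a - t • x0) + t • x := fun x => by
    rw [smul_sub]; abel
  calc ∫⁻ x in T, ENNReal.ofReal (f (a + t • (x - x0)) ^ 2)
      = ∫⁻ x in T, G ((a - t • x0) + t • x) := by
        refine setLIntegral_congr_fun hT.measurableSet fun x hx => ?_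
        simp only [← e, hG]
        rw [Set.indicator_of_mem (hmap x hx)]
    _ ≤ ∫⁻ x, G ((a - t • x0) + t • x) := setLIntegral_le_lintegral _ _
    _ = _ := by
        rw [lintegral_comp_add_smul hGm _ ht.ne', abs_of_pos (by positivity), hG,
          lintegral_indicator hT.measurableSet]

lemma setIntegral_sq_comp_le {T : Set (E d)} (hT : IsOpen T) (hTb : Bornology.IsBounded T)
    {f : E d → ℝ} (hf : Continuous f) (a x0 : E d) {t : ℝ} (ht : 0 < t)
    (hmap : ∀ x ∈ T, a + t • (x - x0) ∈ T) :
    ∫ x in T, f (a + t • (x - x0)) ^ 2 ≤ (t ^ d)⁻¹ * ∫ x in T, f x ^ 2 := by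
  have i1 := (memLp_of_continuous hTb hT.measurableSet hf).integrable_sq
  have i2 := (memLp_of_continuous (f := fun x => f (a + t • (x - x0))) hTb hT.measurableSet
    (by fun_prop)).integrable_sq
  have h := setLIntegral_sq_comp_le hT hf a x0 ht hmap
  rw [← ofReal_integral_eq_lintegral_ofReal i1 (ae_of_all _ fun y => sq_nonneg _),
    ← ofReal_integral_eq_lintegral_ofReal i2 (ae_of_all _ fun y => sq_nonneg _),
    ← ENNReal.ofReal_mul (by positivity)] at h
  exact (ENNReal.ofReal_le_ofReal_iff (mul_nonneg (by positivity)
    (integral_nonneg fun _ => sq_nonneg _))).1 h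

/-- The inverse inequality for second derivatives of polynomials. -/
theorem inverse_inequality (d k : ℕ) {ρ : ℝ} (hρ : 0 < ρ) :
    ∃ C : ℝ, 0 ≤ C ∧ ∀ {T : Set (E d)}, IsOpen T → ∀ {x0 : E d} {H : ℝ}, 0 < H →
      Metric.ball x0 (ρ * H) ⊆ T → (∀ x ∈ T, ‖x - x0‖ ≤ H) →
      ∀ p : MvPolynomial (Fin d) ℝ, p.totalDegree ≤ k → ∀ i : Fin d,
        H ^ 4 * ∫ x in T, partialD ![i, i] (pval p) x ^ 2 ≤ C * ∫ x in T, pval p x ^ 2 := by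
  have hσ : 0 < ρ / 3 := by positivity
  -- The weights a extrapolate to the point 1 from nodes in (0, ρ/3]; the weights b give the second
  -- derivative at 0 from the same nodes.
  obtain ⟨a, ha⟩ := exists_weights k hσ (Polynomial.leval (1 : ℝ))
  obtain ⟨b, hb⟩ := exists_weights k hσ
    (Polynomial.leval (0 : ℝ) ∘ₗ Polynomial.derivative ∘ₗ Polynomial.derivative)
  set t := node k (ρ / 3) with ht
  refine ⟨((k + 1) * (k + 1)) * ∑ m : Fin (k + 1) × Fin (k + 1),
    (b m.1 * a m.2) ^ 2 * (t m.2 ^ d)⁻¹, ?_, ?_⟩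
  · have : ∀ l, 0 < t l := node_pos hσ
    exact mul_nonneg (by positivity) (Finset.sum_nonneg fun m _ =>
      mul_nonneg (sq_nonneg _) (inv_nonneg.2 (pow_nonneg (this _).le _)))
  intro T hT x0 H hH hball hTH p hp i
  have hTb : Bornology.IsBounded T := Metric.isBounded_closedBall.subset
    (fun x hx => by rw [Metric.mem_closedBall, dist_eq_norm]; exact hTH x hx : T ⊆ Metric.closedBall x0 H)
  have hpc := (contDiff_pval p).continuous
  -- The weights b sample the line through x in direction e_i. These samples may leave T, so each is
  -- extrapolated from points contracted towards x0.
  have hrep : ∀ x, H ^ 2 * partialD ![i, i] (pval p) x = ∑ m : Fin (k + 1) × Fin (k + 1),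
      (b m.1 * a m.2) * pval p ((x0 + t m.1 • (H • ei i)) + t m.2 • (x - x0)) := fun x => by
    rw [← eval_derivative_derivative_linePoly]
    have h1 := hb (linePoly p x (H • ei i)) (natDegree_linePoly_le hp _ _)
    simp only [LinearMap.comp_apply, Polynomial.leval_apply] at h1
    rw [h1, Fintype.sum_prod_type]
    refine Finset.sum_congr rfl fun m _ => ?_
    have h2 := ha (linePoly p (x0 + t m • (H • ei i)) (x - x0)) (natDegree_linePoly_le hp _ _)
    rw [Polynomial.leval_apply, eval_linePoly] at h2
    rw [eval_linePoly]
    have e : x + t m • (H • ei i) = x0 + t m • (H • ei i) + (1 : ℝ) • (x - x0) := by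
      rw [one_smul]; abel
    rw [e, h2, Finset.mul_sum]
    refine Finset.sum_congr rfl fun l _ => ?_
    rw [eval_linePoly, mul_assoc]
  -- Both displacements from x0 have length at most ρH/3, so every sample lies in the ball.
  have hmap : ∀ m : Fin (k + 1) × Fin (k + 1), ∀ x ∈ T,
      (x0 + t m.1 • (H • ei i)) + t m.2 • (x - x0) ∈ T := fun m x hx => by
    refine hball ?_
    rw [Metric.mem_ball, dist_eq_norm]
    have h1 : ‖t m.1 • (H • (ei i : E d))‖ ≤ ρ / 3 * H := by
      rw [norm_smul, norm_smul, Real.norm_of_nonneg (node_pos hσ _).le, Real.norm_of_nonneg hH.le]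
      simp only [ei, PiLp.norm_single, norm_one, mul_one]
      exact mul_le_mul_of_nonneg_right (node_le hσ _) hH.le
    have h2 : ‖t m.2 • (x - x0)‖ ≤ ρ / 3 * H := by
      rw [norm_smul, Real.norm_of_nonneg (node_pos hσ _).le]
      exact mul_le_mul (node_le hσ _) (hTH x hx) (norm_nonneg _) hσ.le
    calc ‖x0 + t m.1 • H • ei i + t m.2 • (x - x0) - x0‖
        = ‖t m.1 • H • ei i + t m.2 • (x - x0)‖ := by congr 1; abel
      _ ≤ ρ / 3 * H + ρ / 3 * H := (norm_add_le _ _).trans (add_le_add h1 h2)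
      _ < ρ * H := by nlinarith [mul_pos hρ hH]
  have hi : ∀ m : Fin (k + 1) × Fin (k + 1), Integrable (fun x => (b m.1 * a m.2) ^ 2 *
      pval p ((x0 + t m.1 • (H • ei i)) + t m.2 • (x - x0)) ^ 2) (volume.restrict T) := fun m =>
    (memLp_of_continuous hTb hT.measurableSet (by fun_prop)).integrable_sq.const_mul _
  calc H ^ 4 * ∫ x in T, partialD ![i, i] (pval p) x ^ 2
      = ∫ x in T, (H ^ 2 * partialD ![i, i] (pval p) x) ^ 2 := by
        rw [← integral_const_mul]; congr 1; ext x; ring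
    _ ≤ ∫ x in T, ((k + 1) * (k + 1)) * ∑ m : Fin (k + 1) × Fin (k + 1), (b m.1 * a m.2) ^ 2 *
          pval p ((x0 + t m.1 • (H • ei i)) + t m.2 • (x - x0)) ^ 2 := by
        refine integral_mono ?_ ((integrable_finsetSum _ fun m _ => hi m).const_mul _) fun x => ?_
        · exact (memLp_of_continuous hTb hT.measurableSet (continuous_const.mul
            (contDiff_partialD ![i, i] (contDiff_pval p)).continuous)).integrable_sq
        · simp only [hrep]
          have := sq_sum_le_card_mul_sum_sq (s := (Finset.univ : Finset (Fin (k + 1) × Fin (k + 1))))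
            (f := fun m => (b m.1 * a m.2) *
              pval p ((x0 + t m.1 • (H • ei i)) + t m.2 • (x - x0)))
          simpa [mul_pow] using this
    _ = ((k + 1) * (k + 1)) * ∑ m : Fin (k + 1) × Fin (k + 1), (b m.1 * a m.2) ^ 2 *
          ∫ x in T, pval p ((x0 + t m.1 • (H • ei i)) + t m.2 • (x - x0)) ^ 2 := by
        rw [integral_const_mul, integral_finsetSum _ fun m _ => hi m]
        simp only [integral_const_mul]
    _ ≤ ((k + 1) * (k + 1)) * ∑ m : Fin (k + 1) × Fin (k + 1), (b m.1 * a m.2) ^ 2 *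
          ((t m.2 ^ d)⁻¹ * ∫ x in T, pval p x ^ 2) := by
        refine mul_le_mul_of_nonneg_left (Finset.sum_le_sum fun m _ => ?_) (by positivity)
        exact mul_le_mul_of_nonneg_left (setIntegral_sq_comp_le hT hTb hpc _ _ (node_pos hσ _)
          (hmap m)) (sq_nonneg _)
    _ = _ := by rw [mul_assoc _ (Finset.sum _ _), Finset.sum_mul]; simp only [mul_assoc]

end Inverse

/-! ### Estimates in `L²` -/

section L2

variable {d : ℕ} {T : Set (E d)}

lemma normL2_nonneg (f : E d → ℝ) : 0 ≤ normL2 T f := Real.sqrt_nonneg _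

lemma seminormH_nonneg (m : ℕ) (f : E d → ℝ) : 0 ≤ seminormH m T f := Real.sqrt_nonneg _

lemma sq_normL2 (f : E d → ℝ) : normL2 T f ^ 2 = ∫ x in T, f x ^ 2 :=
  Real.sq_sqrt (integral_nonneg fun _ => sq_nonneg _)

lemma abs_integral_mul_le {f g : E d → ℝ} (hf : MemLp f 2 (volume.restrict T))
    (hg : MemLp g 2 (volume.restrict T)) :
    |∫ x in T, f x * g x| ≤ normL2 T f * normL2 T g := by
  have h1 : |∫ x in T, f x * g x| ≤ ∫ x in T, |f x| * |g x| := by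
    refine (abs_integral_le_integral_abs).trans (le_of_eq ?_)
    simp only [abs_mul]
  have h2 := integral_mul_le_Lp_mul_Lq_of_nonneg (μ := volume.restrict T)
    (p := 2) (q := 2) Real.HolderConjugate.two_two
    (f := fun x => |f x|) (g := fun x => |g x|) (ae_of_all _ fun x => abs_nonneg _)
    (ae_of_all _ fun x => abs_nonneg _) (by simpa using hf.norm) (by simpa using hg.norm)
  refine h1.trans (h2.trans (le_of_eq ?_))
  simp only [Real.rpow_two, sq_abs, ← Real.sqrt_eq_rpow, normL2]

lemma normL2_le_mul {f g : E d → ℝ} (hT : MeasurableSet T) (hg : MemLp g 2 (volume.restrict T))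
    {a : ℝ} (ha : 0 ≤ a) (h : ∀ x ∈ T, |f x| ≤ a * |g x|) : normL2 T f ≤ a * normL2 T g := by
  rw [← Real.sqrt_sq ha, normL2, normL2, ← Real.sqrt_mul (sq_nonneg a), ← integral_const_mul]
  refine Real.sqrt_le_sqrt (integral_mono_of_nonneg (ae_of_all _ fun x => sq_nonneg _)
    (hg.integrable_sq.const_mul _) ?_)
  filter_upwards [ae_restrict_mem hT] with x hx
  calc f x ^ 2 = |f x| ^ 2 := (sq_abs _).symm
    _ ≤ (a * |g x|) ^ 2 := pow_le_pow_left₀ (abs_nonneg _) (h x hx) 2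
    _ = a ^ 2 * g x ^ 2 := by rw [mul_pow, sq_abs]

lemma integral_sq_sub_le {f g : E d → ℝ} (hf : MemLp f 2 (volume.restrict T))
    (hg : MemLp g 2 (volume.restrict T)) :
    ∫ x in T, (f x - g x) ^ 2 ≤ 2 * (∫ x in T, f x ^ 2) + 2 * ∫ x in T, g x ^ 2 := by
  rw [← integral_const_mul, ← integral_const_mul,
    ← integral_add (hf.integrable_sq.const_mul _) (hg.integrable_sq.const_mul _)]
  refine integral_mono (hf.sub hg).integrable_sq
    ((hf.integrable_sq.const_mul _).add (hg.integrable_sq.const_mul _)) fun x => ?_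
  simp only
  nlinarith [sq_nonneg (f x + g x)]

lemma ei_sum_apply (a : Fin d → ℝ) (j : Fin d) : (∑ i, a i • (ei i : E d)) j = a j := by
  simp [ei, Pi.single_apply]

lemma norm_sq_wgrad (u : E d → ℝ) (x : E d) :
    ‖wgrad T u x‖ ^ 2 = ∑ i, weakDeriv T ![i] u x ^ 2 := by
  rw [EuclideanSpace.real_norm_sq_eq]
  simp only [wgrad, ei_sum_apply]

lemma memLp_wgrad {u : E d → ℝ} (hu : ∀ i, HasL2WeakDeriv T ![i] u) :
    MemLp (wgrad T u) 2 (volume.restrict T) := by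
  have := memLp_finsetSum (p := 2) (μ := volume.restrict T) Finset.univ
    (f := fun i : Fin d => fun x => weakDeriv T ![i] u x • (ei i : E d))
    fun i _ => (memLp_weakDeriv (hu i)).of_le_mul (c := 1)
      ((memLp_weakDeriv (hu i)).aestronglyMeasurable.smul_const (ei i))
      (ae_of_all _ fun x => by simp [norm_smul, ei])
  exact this

lemma sum_fin_one {d : ℕ} (F : (Fin 1 → Fin d) → ℝ) : ∑ s, F s = ∑ i, F ![i] := by
  rw [← (Equiv.funUnique (Fin 1) (Fin d)).symm.sum_comp]
  refine Finset.sum_congr rfl fun i _ => congrArg F ?_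
  ext j; fin_cases j; rfl

lemma seminormH_one_eq {u : E d → ℝ} (hu : ∀ i, HasL2WeakDeriv T ![i] u) :
    seminormH 1 T u = normL2 T fun x => ‖wgrad T u x‖ := by
  rw [seminormH, normL2, sum_fin_one,
    ← integral_finsetSum _ fun i _ => (memLp_weakDeriv (hu i)).integrable_sq]
  simp only [norm_sq_wgrad]

lemma memLp_inner_wgrad {u : E d → ℝ} (hT : MeasurableSet T)
    (hu : ∀ i, HasL2WeakDeriv T ![i] u) {b : E d → E d} {β : ℝ}
    (hb : AEStronglyMeasurable b (volume.restrict T)) (hβ : ∀ x ∈ T, ‖b x‖ ≤ β) :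
    MemLp (fun x => inner ℝ (b x) (wgrad T u x)) 2 (volume.restrict T) := by
  have h := memLp_wgrad hu
  refine h.of_le_mul (c := β) (hb.inner h.aestronglyMeasurable) ?_
  filter_upwards [ae_restrict_mem hT] with x hx
  exact (norm_inner_le_norm _ _).trans (mul_le_mul_of_nonneg_right (hβ x hx) (norm_nonneg _))

lemma normL2_inner_wgrad_le {u : E d → ℝ} (hT : MeasurableSet T)
    (hu : ∀ i, HasL2WeakDeriv T ![i] u) {b : E d → E d} {β : ℝ} (hβ0 : 0 ≤ β)
    (hβ : ∀ x ∈ T, ‖b x‖ ≤ β) :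
    normL2 T (fun x => inner ℝ (b x) (wgrad T u x)) ≤ β * seminormH 1 T u := by
  rw [seminormH_one_eq hu]
  refine normL2_le_mul hT (memLp_wgrad hu).norm hβ0 fun x hx => ?_
  rw [abs_of_nonneg (norm_nonneg _)]
  exact (abs_real_inner_le_norm _ _).trans (mul_le_mul_of_nonneg_right (hβ x hx) (norm_nonneg _))

lemma memLp_bdd_mul {u c : E d → ℝ} (hT : MeasurableSet T) (hu : MemLp u 2 (volume.restrict T))
    {γ : ℝ} (hc : AEStronglyMeasurable c (volume.restrict T)) (hγ : ∀ x ∈ T, |c x| ≤ γ) :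
    MemLp (fun x => c x * u x) 2 (volume.restrict T) := by
  refine hu.of_le_mul (c := γ) (hc.mul hu.aestronglyMeasurable) ?_
  filter_upwards [ae_restrict_mem hT] with x hx
  rw [norm_mul]
  exact mul_le_mul_of_nonneg_right (hγ x hx) (norm_nonneg _)

lemma abs_integral_bdd_mul_mul_le {u v c : E d → ℝ} (hT : MeasurableSet T)
    (hu : MemLp u 2 (volume.restrict T)) (hv : MemLp v 2 (volume.restrict T)) {γ : ℝ} (hγ0 : 0 ≤ γ)
    (hc : AEStronglyMeasurable c (volume.restrict T)) (hγ : ∀ x ∈ T, |c x| ≤ γ) :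
    |∫ x in T, c x * u x * v x| ≤ γ * normL2 T u * normL2 T v := by
  refine (abs_integral_mul_le (memLp_bdd_mul hT hu hc hγ) hv).trans ?_
  refine mul_le_mul_of_nonneg_right (normL2_le_mul hT hu hγ0 fun x hx => ?_) (normL2_nonneg _)
  rw [abs_mul]
  exact mul_le_mul_of_nonneg_right (hγ x hx) (abs_nonneg _)

lemma abs_integral_inner_wgrad_le {u v : E d → ℝ} (hu : ∀ i, HasL2WeakDeriv T ![i] u)
    (hv : ∀ i, HasL2WeakDeriv T ![i] v) :
    |∫ x in T, inner ℝ (wgrad T u x) (wgrad T v x)| ≤ seminormH 1 T u * seminormH 1 T v := by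
  have mu := (memLp_wgrad hu).norm
  have mv := (memLp_wgrad hv).norm
  rw [seminormH_one_eq hu, seminormH_one_eq hv]
  refine le_trans ?_ ((le_abs_self _).trans (abs_integral_mul_le mu mv))
  refine norm_integral_le_of_norm_le (f := fun x => inner ℝ (wgrad T u x) (wgrad T v x))
    (mu.integrable_mul (q := 2) mv) (ae_of_all _ fun x => norm_inner_le_norm _ _)

/-- A bound of the elemental form by Cauchy–Schwarz. -/
lemma abs_AT_le {ε δT β γ B : ℝ} (hε : 0 ≤ ε) (hδ : 0 ≤ δT) (hβ0 : 0 ≤ β) (hγ0 : 0 ≤ γ)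
    (hB0 : 0 ≤ B) (hT : MeasurableSet T) {b : E d → E d} {c : E d → ℝ}
    (hb : AEStronglyMeasurable b (volume.restrict T)) (hβ : ∀ x ∈ T, ‖b x‖ ≤ β)
    (hdb : AEStronglyMeasurable (dvg b) (volume.restrict T)) (hB : ∀ x ∈ T, |dvg b x| ≤ B)
    (hc : AEStronglyMeasurable c (volume.restrict T)) (hγ : ∀ x ∈ T, |c x| ≤ γ)
    {w v : E d → ℝ} (hw : MemLp w 2 (volume.restrict T)) (hv : MemLp v 2 (volume.restrict T))
    (hw1 : ∀ i, HasL2WeakDeriv T ![i] w) (hv1 : ∀ i, HasL2WeakDeriv T ![i] v)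
    (hw2 : MemLp (wlap T w) 2 (volume.restrict T)) :
    |AT ε b c δT T w v| ≤ ε * seminormH 1 T w * seminormH 1 T v +
      1 / 2 * (β * seminormH 1 T w * normL2 T v +
        normL2 T w * normL2 T (fun x => inner ℝ (b x) (wgrad T v x)) +
        B * normL2 T w * normL2 T v) + γ * normL2 T w * normL2 T v +
      δT * ((ε * normL2 T (wlap T w) + β * seminormH 1 T w + γ * normL2 T w) *
        normL2 T (fun x => inner ℝ (b x) (wgrad T v x))) := by
  have mbw := memLp_inner_wgrad hT hw1 hb hβ
  have mbv := memLp_inner_wgrad hT hv1 hb hβ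
  have mcw := memLp_bdd_mul hT hw hc hγ
  have hbw := normL2_inner_wgrad_le hT hw1 hβ0 hβ
  have t1 : |∫ x in T, ε * inner ℝ (wgrad T w x) (wgrad T v x)| ≤
      ε * seminormH 1 T w * seminormH 1 T v := by
    rw [integral_const_mul, abs_mul, abs_of_nonneg hε, mul_assoc]
    exact mul_le_mul_of_nonneg_left (abs_integral_inner_wgrad_le hw1 hv1) hε
  have t2 : |∫ x in T, inner ℝ (b x) (wgrad T w x) * v x| ≤ β * seminormH 1 T w * normL2 T v :=
    (abs_integral_mul_le mbw hv).trans (mul_le_mul_of_nonneg_right hbw (normL2_nonneg _))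
  have t3 : |∫ x in T, inner ℝ (b x) (wgrad T v x) * w x| ≤
      normL2 T w * normL2 T (fun x => inner ℝ (b x) (wgrad T v x)) := by
    rw [mul_comm (normL2 T w)]
    exact abs_integral_mul_le mbv hw
  have t4 := abs_integral_bdd_mul_mul_le hT hw hv hB0 hdb hB
  have t5 := abs_integral_bdd_mul_mul_le hT hw hv hγ0 hc hγ
  have t6 : |bTstab ε b c δT T w v| ≤
      δT * ((ε * normL2 T (wlap T w) + β * seminormH 1 T w + γ * normL2 T w) *
        normL2 T (fun x => inner ℝ (b x) (wgrad T v x))) := by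
    set g : E d → ℝ := fun x => inner ℝ (b x) (wgrad T v x) with hg
    have e : bTstab ε b c δT T w v = δT * (-ε * (∫ x in T, wlap T w x * g x) +
        (∫ x in T, inner ℝ (b x) (wgrad T w x) * g x) + ∫ x in T, c x * w x * g x) := by
      have i1 : Integrable (fun x => -ε * (wlap T w x * g x)) (volume.restrict T) :=
        (hw2.integrable_mul (q := 2) mbv).const_mul _
      have i2 : Integrable (fun x => inner ℝ (b x) (wgrad T w x) * g x) (volume.restrict T) :=
        mbw.integrable_mul (q := 2) mbv
      have i3 : Integrable (fun x => c x * w x * g x) (volume.restrict T) :=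
        mcw.integrable_mul (q := 2) mbv
      have i12 : Integrable (fun x => -ε * (wlap T w x * g x) +
        inner ℝ (b x) (wgrad T w x) * g x) (volume.restrict T) := i1.add i2
      rw [← integral_const_mul, ← integral_add i1 i2, ← integral_add i12 i3, ← integral_const_mul,
        bTstab]
      congr 1; ext x; simp only [hg]; ring
    have s1 := abs_integral_mul_le hw2 mbv
    have s2 := (abs_integral_mul_le mbw mbv).trans
      (mul_le_mul_of_nonneg_right hbw (normL2_nonneg _))
    have s3 := abs_integral_bdd_mul_mul_le hT hw mbv hγ0 hc hγ
    rw [e, abs_mul, abs_of_nonneg hδ]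
    refine mul_le_mul_of_nonneg_left ?_ hδ
    refine (abs_add_three _ _ _).trans ?_
    rw [abs_mul, abs_neg, abs_of_nonneg hε, add_mul, add_mul, mul_assoc ε]
    exact add_le_add (add_le_add (mul_le_mul_of_nonneg_left s1 hε) s2) s3
  have t7 : |bT b T w v| ≤ 1 / 2 * (β * seminormH 1 T w * normL2 T v +
        normL2 T w * normL2 T (fun x => inner ℝ (b x) (wgrad T v x)) +
        B * normL2 T w * normL2 T v) := by
    rw [bT, abs_mul, abs_of_nonneg (by norm_num : (0 : ℝ) ≤ 1 / 2)]
    refine mul_le_mul_of_nonneg_left ?_ (by norm_num)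
    exact (abs_sub _ _).trans (add_le_add ((abs_sub _ _).trans (add_le_add t2 t3)) t4)
  rw [AT]
  refine (abs_add_le _ _).trans (add_le_add ((abs_add_three _ _ _).trans ?_) t6)
  exact add_le_add (add_le_add t1 t7) t5

end L2

/-! ### Differences of a Sobolev function and a polynomial -/

section Difference

variable {d : ℕ} {T : Set (E d)}

lemma memLp_partialD (hTb : Bornology.IsBounded T) (hT : IsOpen T) {n : ℕ} (s : Fin n → Fin d)
    (p : MvPolynomial (Fin d) ℝ) : MemLp (partialD s (pval p)) 2 (volume.restrict T) :=
  memLp_of_continuous hTb hT.measurableSet (contDiff_partialD s (contDiff_pval p)).continuous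

lemma memLp_pval (hTb : Bornology.IsBounded T) (hT : IsOpen T) (p : MvPolynomial (Fin d) ℝ) :
    MemLp (pval p) 2 (volume.restrict T) :=
  memLp_of_continuous hTb hT.measurableSet (contDiff_pval p).continuous

lemma isWeakDeriv_pval_sub (hTb : Bornology.IsBounded T) (hT : IsOpen T) {n : ℕ} {s : Fin n → Fin d}
    {u : E d → ℝ} (hu : MemLp u 2 (volume.restrict T)) (h : HasL2WeakDeriv T s u)
    (p : MvPolynomial (Fin d) ℝ) :
    IsWeakDeriv T s (fun x => pval p x - u x)
      (fun x => partialD s (pval p) x - weakDeriv T s u x) :=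
  IsWeakDeriv.sub (memLp_pval hTb hT p) hu (memLp_partialD hTb hT s p) (memLp_weakDeriv h)
    (isWeakDeriv_of_contDiff s (contDiff_pval p)) (isWeakDeriv_weakDeriv h)

lemma hasL2WeakDeriv_pval_sub (hTb : Bornology.IsBounded T) (hT : IsOpen T) {n : ℕ}
    {s : Fin n → Fin d} {u : E d → ℝ} (hu : MemLp u 2 (volume.restrict T))
    (h : HasL2WeakDeriv T s u) (p : MvPolynomial (Fin d) ℝ) :
    HasL2WeakDeriv T s (fun x => pval p x - u x) :=
  ⟨_, (memLp_partialD hTb hT s p).sub (memLp_weakDeriv h), isWeakDeriv_pval_sub hTb hT hu h p⟩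

lemma weakDeriv_pval_sub_ae_eq (hTb : Bornology.IsBounded T) (hT : IsOpen T) {n : ℕ}
    {s : Fin n → Fin d} {u : E d → ℝ} (hu : MemLp u 2 (volume.restrict T))
    (h : HasL2WeakDeriv T s u) (p : MvPolynomial (Fin d) ℝ) :
    weakDeriv T s (fun x => pval p x - u x) =ᵐ[volume.restrict T]
      fun x => partialD s (pval p) x - weakDeriv T s u x :=
  (isWeakDeriv_pval_sub hTb hT hu h p).weakDeriv_ae_eq hT
    ((memLp_partialD hTb hT s p).sub (memLp_weakDeriv h))

lemma sq_seminormH_sub_pval (hTb : Bornology.IsBounded T) (hT : IsOpen T) {m n : ℕ} (hn : n ≤ m)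
    {u : E d → ℝ} (hu : MemH m T u) (p : MvPolynomial (Fin d) ℝ) :
    seminormH n T (fun x => u x - pval p x) ^ 2 = jetDist n T u p := by
  rw [sq_seminormH, jetDist]
  refine Finset.sum_congr rfl fun s _ => integral_congr_ae ?_
  filter_upwards [(isWeakDeriv_sub_pval hTb hT hu.1 (hu.2 n hn s) p).weakDeriv_ae_eq hT
    (memLp_weakDeriv_sub hTb hT (hu.2 n hn s) p)] with x hx
  rw [hx]

/-- `weakDeriv` need not respect a sign change pointwise, so both orders of subtraction are compared
through `jetDist`. -/
lemma sq_seminormH_pval_sub (hTb : Bornology.IsBounded T) (hT : IsOpen T) {m n : ℕ} (hn : n ≤ m)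
    {u : E d → ℝ} (hu : MemH m T u) (p : MvPolynomial (Fin d) ℝ) :
    seminormH n T (fun x => pval p x - u x) ^ 2 = jetDist n T u p := by
  rw [sq_seminormH, jetDist]
  refine Finset.sum_congr rfl fun s _ => integral_congr_ae ?_
  filter_upwards [weakDeriv_pval_sub_ae_eq hTb hT hu.1 (hu.2 n hn s) p] with x hx
  rw [hx]; ring

lemma sq_normL2_sub_pval (hT : IsOpen T) {u : E d → ℝ} (hu : MemLp u 2 (volume.restrict T))
    (p : MvPolynomial (Fin d) ℝ) : normL2 T (fun x => u x - pval p x) ^ 2 = jetDist 0 T u p := by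
  rw [sq_normL2, jetDist, Fintype.sum_unique]
  refine integral_congr_ae ?_
  filter_upwards [(isWeakDeriv_zero default u).weakDeriv_ae_eq hT hu] with x hx
  rw [hx, partialD_zero]

lemma normL2_sub_comm (f g : E d → ℝ) :
    normL2 T (fun x => f x - g x) = normL2 T (fun x => g x - f x) := by
  simp only [normL2, sub_sq_comm]

lemma wlap_pval_sub_ae_eq (hTb : Bornology.IsBounded T) (hT : IsOpen T) {u : E d → ℝ}
    (hu : MemH 2 T u) (p : MvPolynomial (Fin d) ℝ) :
    wlap T (fun x => pval p x - u x) =ᵐ[volume.restrict T]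
      fun x => ∑ i, (partialD ![i, i] (pval p) x - weakDeriv T ![i, i] u x) := by
  have h : ∀ᵐ x ∂(volume.restrict T), ∀ i, weakDeriv T ![i, i] (fun x => pval p x - u x) x =
      partialD ![i, i] (pval p) x - weakDeriv T ![i, i] u x :=
    ae_all_iff.2 fun i => weakDeriv_pval_sub_ae_eq hTb hT hu.1 (hu.2 2 le_rfl _) p
  filter_upwards [h] with x hx
  exact Finset.sum_congr rfl fun i _ => hx i

lemma memLp_wlap_pval_sub (hTb : Bornology.IsBounded T) (hT : IsOpen T) {u : E d → ℝ}
    (hu : MemH 2 T u) (p : MvPolynomial (Fin d) ℝ) :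
    MemLp (wlap T (fun x => pval p x - u x)) 2 (volume.restrict T) := by
  refine (memLp_congr_ae (wlap_pval_sub_ae_eq hTb hT hu p)).2 ?_
  exact memLp_finsetSum _ fun i _ =>
    (memLp_partialD hTb hT ![i, i] p).sub (memLp_weakDeriv (hu.2 2 le_rfl _))

lemma integral_sq_weakDeriv_sub_le_jetDist {n : ℕ} (s : Fin n → Fin d) (u : E d → ℝ)
    (q : MvPolynomial (Fin d) ℝ) :
    ∫ x in T, (weakDeriv T s u x - partialD s (pval q) x) ^ 2 ≤ jetDist n T u q :=
  Finset.single_le_sum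
    (f := fun s : Fin n → Fin d => ∫ x in T, (weakDeriv T s u x - partialD s (pval q) x) ^ 2)
    (fun _ _ => integral_nonneg fun _ => sq_nonneg _) (Finset.mem_univ s)

lemma pval_sub (p q : MvPolynomial (Fin d) ℝ) : pval (p - q) = fun x => pval p x - pval q x := by
  ext x; simp [pval]

lemma partialD_pval_sub {n : ℕ} (s : Fin n → Fin d) (p q : MvPolynomial (Fin d) ℝ) (x : E d) :
    partialD s (pval (p - q)) x = partialD s (pval p) x - partialD s (pval q) x := by
  have h := partialD_add s (contDiff_pval (p - q)) (contDiff_pval q)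
  rw [← pval_add, sub_add_cancel] at h
  rw [h]; ring

/-- The Laplacian of the difference of a Sobolev function and one polynomial, bounded through
another polynomial. -/
lemma integral_sq_wlap_pval_sub_le (hTb : Bornology.IsBounded T) (hT : IsOpen T) {u : E d → ℝ}
    (hu : MemH 2 T u) (p q : MvPolynomial (Fin d) ℝ) :
    ∫ x in T, wlap T (fun x => pval p x - u x) x ^ 2 ≤
      d * ∑ i : Fin d, (2 * (∫ x in T, partialD ![i, i] (pval (p - q)) x ^ 2) +
        2 * jetDist 2 T u q) := by
  have m1 : ∀ i : Fin d, MemLp (partialD ![i, i] (pval (p - q))) 2 (volume.restrict T) := fun i =>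
    memLp_partialD hTb hT _ _
  have m2 : ∀ i : Fin d, MemLp (fun x => weakDeriv T ![i, i] u x - partialD ![i, i] (pval q) x) 2
      (volume.restrict T) := fun i => memLp_weakDeriv_sub hTb hT (hu.2 2 le_rfl _) q
  have m3 : ∀ i : Fin d, Integrable (fun x => (partialD ![i, i] (pval (p - q)) x -
      (weakDeriv T ![i, i] u x - partialD ![i, i] (pval q) x)) ^ 2) (volume.restrict T) := fun i =>
    ((m1 i).sub (m2 i)).integrable_sq
  calc ∫ x in T, wlap T (fun x => pval p x - u x) x ^ 2
      ≤ ∫ x in T, d * ∑ i : Fin d, (partialD ![i, i] (pval (p - q)) x -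
          (weakDeriv T ![i, i] u x - partialD ![i, i] (pval q) x)) ^ 2 := by
        refine integral_mono_ae (memLp_wlap_pval_sub hTb hT hu p).integrable_sq
          ((integrable_finsetSum _ fun i _ => m3 i).const_mul _) ?_
        filter_upwards [wlap_pval_sub_ae_eq hTb hT hu p] with x hx
        -- Inserting q isolates a polynomial, p - q, to which an inverse inequality can apply.
        have e : ∀ i, partialD ![i, i] (pval p) x - weakDeriv T ![i, i] u x =
            partialD ![i, i] (pval (p - q)) x -
              (weakDeriv T ![i, i] u x - partialD ![i, i] (pval q) x) := fun i => by
          rw [partialD_pval_sub]; ring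
        simp only [hx, e]
        simpa using sq_sum_le_card_mul_sum_sq (s := (Finset.univ : Finset (Fin d)))
          (f := fun i => partialD ![i, i] (pval (p - q)) x -
              (weakDeriv T ![i, i] u x - partialD ![i, i] (pval q) x))
    _ = d * ∑ i : Fin d, ∫ x in T, (partialD ![i, i] (pval (p - q)) x -
          (weakDeriv T ![i, i] u x - partialD ![i, i] (pval q) x)) ^ 2 := by
        rw [integral_const_mul, integral_finsetSum _ fun i _ => m3 i]
    _ ≤ _ := by
        refine mul_le_mul_of_nonneg_left (Finset.sum_le_sum fun i _ => ?_) (Nat.cast_nonneg d)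
        refine (integral_sq_sub_le (m1 i) (m2 i)).trans ?_
        have := integral_sq_weakDeriv_sub_le_jetDist (T := T) ![i, i] u q
        linarith

end Difference

/-! ### Local approximation estimates on an element -/

section Element

variable {d : ℕ} {T : Set (E d)}

/-- Positive dimension provides a direction in which to move inside T. -/
lemma diam_pos_of_isOpen (hd : 0 < d) (hT : IsOpen T) (hTb : Bornology.IsBounded T)
    (hne : T.Nonempty) : 0 < Metric.diam T := by
  obtain ⟨x, hx⟩ := hne
  obtain ⟨r, hr, hb⟩ := Metric.isOpen_iff.1 hT x hx
  have hn : ‖(r / 2) • (ei ⟨0, hd⟩ : E d)‖ = r / 2 := by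
    rw [norm_smul, Real.norm_of_nonneg (by positivity)]; simp [ei]
  have hy : x + (r / 2) • ei ⟨0, hd⟩ ∈ T := hb (by
    rw [Metric.mem_ball, dist_self_add_left, hn]; linarith)
  have h := Metric.dist_le_diam_of_mem hTb hx hy
  rw [dist_self_add_right, hn] at h
  linarith

lemma norm_sub_le_diam (hTb : Bornology.IsBounded T) :
    ∀ x ∈ T, ∀ y ∈ T, ‖x - y‖ ≤ Metric.diam T := fun x hx y hy => by
  rw [← dist_eq_norm]; exact Metric.dist_le_diam_of_mem hTb hx hy

lemma exists_ball_starConvex (hne : T.Nonempty) {ρ : ℝ}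
    (h : ∃ (x : E d) (r : ℝ), ρ * Metric.diam T ≤ r ∧ ∀ y ∈ Metric.ball x r, StarConvex ℝ y T) :
    ∃ x : E d, (∀ y ∈ Metric.ball x (ρ * Metric.diam T), StarConvex ℝ y T) ∧
      Metric.ball x (ρ * Metric.diam T) ⊆ T := by
  obtain ⟨x, r, hr, hs⟩ := h
  have hs' : ∀ y ∈ Metric.ball x (ρ * Metric.diam T), StarConvex ℝ y T :=
    fun y hy => hs y (Metric.ball_subset_ball hr hy)
  exact ⟨x, hs', fun y hy => (hs' y hy).mem hne⟩

/-- The constant in the Bramble–Hilbert lemma. -/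
def bhConst (d : ℕ) (ρ : ℝ) : ℝ := 2 ^ d * (1 + (ρ ^ d)⁻¹)

lemma bhConst_pos (d : ℕ) {ρ : ℝ} (hρ : 0 < ρ) : 0 < bhConst d ρ := by
  unfold bhConst; positivity

/-- The Bramble–Hilbert lemma on a star-shaped element. -/
lemma exists_polynomial_jetDist_le (hd : 0 < d) (hT : IsOpen T) (hTb : Bornology.IsBounded T)
    (hne : T.Nonempty) {ρ : ℝ} (hρ : 0 < ρ)
    (h : ∃ (x : E d) (r : ℝ), ρ * Metric.diam T ≤ r ∧ ∀ y ∈ Metric.ball x r, StarConvex ℝ y T)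
    {k : ℕ} {u : E d → ℝ} (hu : MemH (k + 1) T u) :
    ∃ q : MvPolynomial (Fin d) ℝ, q.totalDegree ≤ k ∧ ∀ n m, n + m = k + 1 →
      jetDist n T u q ≤
        (bhConst d ρ * Metric.diam T ^ 2) ^ m * seminormH (k + 1) T u ^ 2 := by
  obtain ⟨x, hs, hb⟩ := exists_ball_starConvex hne h
  exact bramble_hilbert hT hρ (diam_pos_of_isOpen hd hT hTb hne) hs hb (norm_sub_le_diam hTb) hu

/-- Orders 0 and 1 of the Bramble–Hilbert estimate, with square roots taken. -/
lemma exists_polynomial_approx (hd : 0 < d) (hT : IsOpen T) (hTb : Bornology.IsBounded T)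
    (hne : T.Nonempty) {ρ : ℝ} (hρ : 0 < ρ)
    (h : ∃ (x : E d) (r : ℝ), ρ * Metric.diam T ≤ r ∧ ∀ y ∈ Metric.ball x r, StarConvex ℝ y T)
    {k : ℕ} {u : E d → ℝ} (hu : MemH (k + 1) T u) :
    ∃ q : MvPolynomial (Fin d) ℝ, q.totalDegree ≤ k ∧
      normL2 T (fun x => u x - pval q x) +
        Metric.diam T * seminormH 1 T (fun x => u x - pval q x) ≤
      (√(bhConst d ρ) ^ (k + 1) + √(bhConst d ρ) ^ k) * Metric.diam T ^ (k + 1) *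
        seminormH (k + 1) T u := by
  obtain ⟨q, hq, hj⟩ := exists_polynomial_jetDist_le hd hT hTb hne hρ h hu
  refine ⟨q, hq, ?_⟩
  have hK := (bhConst_pos d hρ).le
  set K := bhConst d ρ
  have hH := (diam_pos_of_isOpen hd hT hTb hne).le
  set H := Metric.diam T
  have hX := seminormH_nonneg (T := T) (k + 1) u
  set X := seminormH (k + 1) T u
  have e : ∀ m, (K * H ^ 2) ^ m * X ^ 2 = ((√K * H) ^ m * X) ^ 2 := fun m => by
    rw [mul_pow _ X, ← pow_mul, mul_comm m 2, pow_mul, mul_pow (√K), Real.sq_sqrt hK]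
  have h0 : normL2 T (fun x => u x - pval q x) ≤ (√K * H) ^ (k + 1) * X := by
    refine (pow_le_pow_iff_left₀ (normL2_nonneg _) (by positivity) two_ne_zero).1 ?_
    rw [sq_normL2_sub_pval hT hu.1, ← e]
    exact hj 0 (k + 1) (by omega)
  have h1 : seminormH 1 T (fun x => u x - pval q x) ≤ (√K * H) ^ k * X := by
    refine (pow_le_pow_iff_left₀ (seminormH_nonneg _ _) (by positivity) two_ne_zero).1 ?_
    rw [sq_seminormH_sub_pval hTb hT (by omega) hu, ← e]
    exact hj 1 k (by omega)
  calc normL2 T (fun x => u x - pval q x) + H * seminormH 1 T (fun x => u x - pval q x)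
      ≤ (√K * H) ^ (k + 1) * X + H * ((√K * H) ^ k * X) :=
        add_le_add h0 (mul_le_mul_of_nonneg_left h1 hH)
    _ = _ := by rw [mul_pow, mul_pow]; ring

lemma MemH.mono {m n : ℕ} (hmn : n ≤ m) {u : E d → ℝ} (hu : MemH m T u) : MemH n T u :=
  ⟨hu.1, fun j hj => hu.2 j (hj.trans hmn)⟩

/-- The Laplacian of the error of a polynomial approximation. -/
lemma exists_normL2_wlap_le (d : ℕ) (hd : 0 < d) {k : ℕ} (hk : 1 ≤ k) {ρ : ℝ} (hρ : 0 < ρ)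
    {Cp : ℝ} (hCp : 0 < Cp) :
    ∃ C : ℝ, 0 ≤ C ∧ ∀ {T : Set (E d)}, IsOpen T → Bornology.IsBounded T → T.Nonempty →
      (∃ (x : E d) (r : ℝ), ρ * Metric.diam T ≤ r ∧ ∀ y ∈ Metric.ball x r, StarConvex ℝ y T) →
      ∀ {u : E d → ℝ}, MemH (k + 1) T u → ∀ {p : MvPolynomial (Fin d) ℝ}, p.totalDegree ≤ k →
      normL2 T (fun x => u x - pval p x) ≤
        Cp * Metric.diam T ^ (k + 1) * seminormH (k + 1) T u →
      Metric.diam T * normL2 T (wlap T fun x => pval p x - u x) ≤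
        C * (Metric.diam T ^ k * seminormH (k + 1) T u) := by
  obtain ⟨Ci, hCi, hinv⟩ := inverse_inequality d k hρ
  set K := bhConst d ρ with hKdef
  have hK := (bhConst_pos d hρ).le
  set A : ℝ := d * (d * (2 * (Ci * (2 * Cp ^ 2 + 2 * K ^ (k + 1))) + 2 * K ^ (k - 1))) with hA
  have hA0 : 0 ≤ A := by positivity
  refine ⟨√A, Real.sqrt_nonneg _, ?_⟩
  intro T hT hTb hne hstar u hu p hp hup
  obtain ⟨q, hq, hj⟩ := exists_polynomial_jetDist_le hd hT hTb hne hρ hstar hu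
  obtain ⟨x0, hs, hb⟩ := exists_ball_starConvex hne hstar
  have hH := diam_pos_of_isOpen hd hT hTb hne
  have hx0 : x0 ∈ T := hb (Metric.mem_ball_self (by positivity))
  have hTH : ∀ x ∈ T, ‖x - x0‖ ≤ Metric.diam T := fun x hx => norm_sub_le_diam hTb x hx x0 hx0
  set H := Metric.diam T
  have hX := seminormH_nonneg (T := T) (k + 1) u
  set X := seminormH (k + 1) T u
  set Y := H ^ (k + 1) * X with hY
  have hu2 : MemH 2 T u := hu.mono (by omega)
  have mp := (memLp_pval hTb hT p).sub hu.1
  have mq := (memLp_pval hTb hT q).sub hu.1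
  -- Both polynomials are L²-close to u, hence to each other.
  have hpq : ∫ x in T, pval (p - q) x ^ 2 ≤ (2 * Cp ^ 2 + 2 * K ^ (k + 1)) * Y ^ 2 := by
    have e : ∀ x, pval (p - q) x = (pval p x - u x) - (pval q x - u x) := fun x => by
      rw [pval_sub]; ring
    simp only [e]
    refine (integral_sq_sub_le mp mq).trans ?_
    have h1 : ∫ x in T, (pval p x - u x) ^ 2 ≤ Cp ^ 2 * Y ^ 2 := by
      rw [← sq_normL2, normL2_sub_comm, ← mul_pow]
      exact pow_le_pow_left₀ (normL2_nonneg _) (hup.trans_eq (by rw [hY]; ring)) 2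
    have h2 : ∫ x in T, (pval q x - u x) ^ 2 ≤ K ^ (k + 1) * Y ^ 2 := by
      rw [← sq_normL2, normL2_sub_comm, sq_normL2_sub_pval hT hu.1]
      refine (hj 0 (k + 1) (by omega)).trans_eq ?_
      rw [hY, mul_pow, ← pow_mul, mul_pow, ← pow_mul, mul_comm 2 (k + 1), mul_assoc]
    simp only [Pi.sub_apply] at h1 h2 ⊢
    linarith
  have hj2 : H ^ 4 * jetDist 2 T u q ≤ K ^ (k - 1) * Y ^ 2 := by
    -- Second derivatives are within reach because k is at least 1.
    refine (mul_le_mul_of_nonneg_left (hj 2 (k - 1) (by omega)) (by positivity)).trans_eq ?_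
    obtain ⟨j, rfl⟩ : ∃ j, k = j + 1 := ⟨k - 1, by omega⟩
    rw [hY, Nat.add_sub_cancel, mul_pow, ← pow_mul]
    ring
  -- An extra factor H on each side gives the H⁴ of the inverse inequality after squaring; it is
  -- cancelled at the end.
  have hsq : (H ^ 2 * normL2 T (wlap T fun x => pval p x - u x)) ^ 2 ≤ (√A * Y) ^ 2 := by
    rw [mul_pow, sq_normL2, mul_pow, Real.sq_sqrt hA0, ← pow_mul]
    calc H ^ (2 * 2) * ∫ x in T, wlap T (fun x => pval p x - u x) x ^ 2
        ≤ H ^ (2 * 2) * (d * ∑ i : Fin d, (2 * (∫ x in T, partialD ![i, i] (pval (p - q)) x ^ 2) +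
            2 * jetDist 2 T u q)) :=
          mul_le_mul_of_nonneg_left (integral_sq_wlap_pval_sub_le hTb hT hu2 p q) (by positivity)
      _ = d * ∑ i : Fin d, (2 * (H ^ 4 * ∫ x in T, partialD ![i, i] (pval (p - q)) x ^ 2) +
            2 * (H ^ 4 * jetDist 2 T u q)) := by
          rw [mul_left_comm, Finset.mul_sum]
          congr 1
          refine Finset.sum_congr rfl fun i _ => ?_
          ring
      _ ≤ d * ∑ _i : Fin d, (2 * (Ci * ((2 * Cp ^ 2 + 2 * K ^ (k + 1)) * Y ^ 2)) +
            2 * (K ^ (k - 1) * Y ^ 2)) := by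
          refine mul_le_mul_of_nonneg_left (Finset.sum_le_sum fun i _ => ?_) (Nat.cast_nonneg d)
          have h1 := hinv hT hH hb hTH (p - q)
            ((MvPolynomial.totalDegree_sub _ _).trans (max_le hp hq)) i
          have h2 := mul_le_mul_of_nonneg_left hpq hCi
          linarith
      _ = _ := by
          rw [Finset.sum_const, Finset.card_univ, Fintype.card_fin, nsmul_eq_mul, hA]
          ring
  have h := (pow_le_pow_iff_left₀ (mul_nonneg (by positivity) (normL2_nonneg _))
    (by positivity) two_ne_zero).1 hsq
  refine le_of_mul_le_mul_left ?_ hH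
  calc H * (H * normL2 T (wlap T fun x => pval p x - u x))
      = H ^ 2 * normL2 T (wlap T fun x => pval p x - u x) := by ring
    _ ≤ √A * Y := h
    _ = _ := by rw [hY]; ring

end Element

/-! ### The estimate on one element, in terms of real numbers -/

/-- Here e, s, r stand for √ε, √δ_T, √η_T, N for the local norm, W0, W1, W2 for the norms of w, ∇w,
Δw, and D0, D1, Db for those of δ, ∇δ, b·∇δ. The letter `c0` stands for the square root of the
coercivity constant. Every factor of δ is paired with its weight in N, and the remaining factors
reduce to r Y. -/
lemma consistency_algebra {Cp C2 κ κ₂ κ₃ B c0 ε e D s r H Y N β γ W0 W1 W2 D0 D1 Db : ℝ}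
    (hCp : 0 ≤ Cp) (hκ : 0 ≤ κ) (hκ₂ : 0 ≤ κ₂) (hκ₃ : 0 ≤ κ₃) (hB : 0 ≤ B)
    (hc0 : 0 < c0) (he : 0 ≤ e) (hs : 0 < s) (hY : 0 ≤ Y) (hγ : 0 ≤ γ)
    (hβ : 0 ≤ β) (hε : ε = e ^ 2) (hD : D = s ^ 2)
    (hW0' : 0 ≤ W0) (hW1' : 0 ≤ W1) (hW2' : 0 ≤ W2) (hDb : 0 ≤ Db)
    (hW0 : W0 ≤ Cp * (H * Y)) (hW1 : W1 ≤ Cp * Y) (hW2 : H * W2 ≤ C2 * Y)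
    (hD1 : e * D1 ≤ N) (hD0 : c0 * D0 ≤ N) (hDbN : s * Db ≤ N) (hN : 0 ≤ N)
    (her : e ≤ r) (hHr : H ≤ r) (hHsr : H ≤ r * s)
    (hβs : β * s ≤ κ * H) (hes : e * s ≤ κ₂ * H) (hγs : γ * s ≤ κ₃) :
    ε * W1 * D1 + 1 / 2 * (β * W1 * D0 + W0 * Db + B * W0 * D0) + γ * W0 * D0 +
        D * ((ε * W2 + β * W1 + γ * W0) * Db) ≤
      (Cp + 1 / 2 * (κ * Cp / c0 + Cp + B * Cp / c0) + γ * Cp / c0 + κ₂ * C2 + κ * Cp + κ₃ * Cp) *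
        (r * Y * N) := by
  have hr : 0 ≤ r := he.trans her
  -- Cancelling s between β s ≤ κ H and H ≤ r s yields a bound on the convection itself, for the
  -- term where no power of s is available.
  have hβr : β ≤ κ * r := by
    refine le_of_mul_le_mul_right (hβs.trans ?_) hs
    calc κ * H ≤ κ * (r * s) := mul_le_mul_of_nonneg_left hHsr hκ
      _ = κ * r * s := by ring
  have hD0' : D0 ≤ N / c0 := by rw [le_div_iff₀ hc0]; linarith
  have hNc : 0 ≤ N / c0 := by positivity
  have hW0r : W0 ≤ Cp * (r * Y) :=
    hW0.trans (mul_le_mul_of_nonneg_left (mul_le_mul_of_nonneg_right hHr hY) hCp)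
  have t1 : ε * W1 * D1 ≤ Cp * (r * Y * N) := by
    calc ε * W1 * D1 = (e * W1) * (e * D1) := by rw [hε]; ring
      _ ≤ (r * (Cp * Y)) * N :=
          (mul_le_mul_of_nonneg_left hD1 (by positivity)).trans
            (mul_le_mul_of_nonneg_right (mul_le_mul her hW1 hW1' hr) hN)
      _ = _ := by ring
  have t2 : β * W1 * D0 ≤ κ * Cp / c0 * (r * Y * N) := by
    calc β * W1 * D0 ≤ β * W1 * (N / c0) := mul_le_mul_of_nonneg_left hD0' (by positivity)
      _ ≤ (κ * r) * (Cp * Y) * (N / c0) :=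
          mul_le_mul_of_nonneg_right (mul_le_mul hβr hW1 hW1' (by positivity)) hNc
      _ = _ := by ring
  have t3 : W0 * Db ≤ Cp * (r * Y * N) := by
    calc W0 * Db ≤ (Cp * ((r * s) * Y)) * Db := mul_le_mul_of_nonneg_right (hW0.trans
          (mul_le_mul_of_nonneg_left (mul_le_mul_of_nonneg_right hHsr hY) hCp)) hDb
      _ = (Cp * r * Y) * (s * Db) := by ring
      _ ≤ (Cp * r * Y) * N := mul_le_mul_of_nonneg_left hDbN (by positivity)
      _ = _ := by ring
  have tW : W0 * D0 ≤ Cp / c0 * (r * Y * N) := by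
    calc W0 * D0 ≤ W0 * (N / c0) := mul_le_mul_of_nonneg_left hD0' hW0'
      _ ≤ (Cp * (r * Y)) * (N / c0) := mul_le_mul_of_nonneg_right hW0r hNc
      _ = _ := by ring
  have t4 : B * W0 * D0 ≤ B * Cp / c0 * (r * Y * N) := by
    calc B * W0 * D0 = B * (W0 * D0) := by ring
      _ ≤ B * (Cp / c0 * (r * Y * N)) := mul_le_mul_of_nonneg_left tW hB
      _ = _ := by ring
  have t5 : γ * W0 * D0 ≤ γ * Cp / c0 * (r * Y * N) := by
    calc γ * W0 * D0 = γ * (W0 * D0) := by ring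
      _ ≤ γ * (Cp / c0 * (r * Y * N)) := mul_le_mul_of_nonneg_left tW hγ
      _ = _ := by ring
  have t6 : D * (ε * W2 * Db) ≤ κ₂ * C2 * (r * Y * N) := by
    calc D * (ε * W2 * Db) = (e * (e * s) * W2) * (s * Db) := by rw [hε, hD]; ring
      _ ≤ (r * (κ₂ * H) * W2) * N :=
          (mul_le_mul_of_nonneg_left hDbN (by positivity)).trans (mul_le_mul_of_nonneg_right
            (mul_le_mul_of_nonneg_right (mul_le_mul her hes (by positivity) hr) hW2') hN)
      _ = (r * κ₂ * N) * (H * W2) := by ring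
      _ ≤ (r * κ₂ * N) * (C2 * Y) := mul_le_mul_of_nonneg_left hW2 (by positivity)
      _ = _ := by ring
  have t7 : D * (β * W1 * Db) ≤ κ * Cp * (r * Y * N) := by
    calc D * (β * W1 * Db) = ((β * s) * W1) * (s * Db) := by rw [hD]; ring
      _ ≤ ((κ * r) * (Cp * Y)) * N :=
          (mul_le_mul_of_nonneg_left hDbN (by positivity)).trans (mul_le_mul_of_nonneg_right
            (mul_le_mul (hβs.trans (mul_le_mul_of_nonneg_left hHr hκ)) hW1 hW1' (by positivity)) hN)
      _ = _ := by ring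
  have t8 : D * (γ * W0 * Db) ≤ κ₃ * Cp * (r * Y * N) := by
    calc D * (γ * W0 * Db) = ((γ * s) * W0) * (s * Db) := by rw [hD]; ring
      _ ≤ (κ₃ * (Cp * (r * Y))) * N :=
          (mul_le_mul_of_nonneg_left hDbN (by positivity)).trans (mul_le_mul_of_nonneg_right
            (mul_le_mul hγs hW0r hW0' hκ₃) hN)
      _ = _ := by ring
  calc ε * W1 * D1 + 1 / 2 * (β * W1 * D0 + W0 * Db + B * W0 * D0) + γ * W0 * D0 +
        D * ((ε * W2 + β * W1 + γ * W0) * Db)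
      = ε * W1 * D1 + 1 / 2 * (β * W1 * D0 + W0 * Db + B * W0 * D0) + γ * W0 * D0 +
        (D * (ε * W2 * Db) + D * (β * W1 * Db) + D * (γ * W0 * Db)) := by ring
    _ ≤ Cp * (r * Y * N) + 1 / 2 * (κ * Cp / c0 * (r * Y * N) + Cp * (r * Y * N) +
          B * Cp / c0 * (r * Y * N)) + γ * Cp / c0 * (r * Y * N) +
        (κ₂ * C2 * (r * Y * N) + κ * Cp * (r * Y * N) + κ₃ * Cp * (r * Y * N)) := by gcongr
    _ = _ := by ring

/-! ### Bounds on the data, and the consistency error on one element. -/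

section Global

variable {d : ℕ} {Ω T : Set (E d)}

lemma le_supNorm {F : Type*} [Norm F] {f : E d → F} (h : ∃ B : ℝ, ∀ x ∈ Ω, ‖f x‖ ≤ B) :
    ∀ x ∈ Ω, ‖f x‖ ≤ supNorm Ω f := by
  obtain ⟨B, hB⟩ := h
  intro x hx
  exact le_ciSup (f := fun x : Ω => ‖f x‖) ⟨B, by rintro _ ⟨y, rfl⟩; exact hB y y.2⟩ ⟨x, hx⟩

lemma supNorm_nonneg {F : Type*} [SeminormedAddCommGroup F] (f : E d → F) : 0 ≤ supNorm Ω f :=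
  Real.iSup_nonneg fun _ => norm_nonneg _

lemma abs_dvg_le {b : E d → E d} {B : ℝ} {x : E d} (h : ‖fderiv ℝ b x‖ ≤ B) :
    |dvg b x| ≤ d * B := by
  refine (Finset.abs_sum_le_sum_abs _ _).trans ?_
  refine (Finset.sum_le_card_nsmul _ _ B fun i _ => ?_).trans (by simp)
  calc |fderiv ℝ b x (ei i) i| ≤ ‖fderiv ℝ b x (ei i)‖ :=
        PiLp.norm_apply_le (fderiv ℝ b x (ei i)) i
    _ ≤ ‖fderiv ℝ b x‖ * ‖(ei i : E d)‖ := ContinuousLinearMap.le_opNorm _ _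
    _ ≤ B := by simpa [ei] using h

lemma continuousOn_dvg (hΩ : IsOpen Ω) {b : E d → E d} (hb : ContDiffOn ℝ 1 b Ω) :
    ContinuousOn (dvg b) Ω := by
  have h := hb.continuousOn_fderiv_of_isOpen hΩ le_rfl
  unfold dvg
  refine continuousOn_finsetSum _ fun i _ => ?_
  have h1 : ContinuousOn (fun x => fderiv ℝ b x (ei i)) Ω := h.clm_apply continuousOn_const
  exact (EuclideanSpace.proj i : E d →L[ℝ] ℝ).continuous.comp_continuousOn h1

lemma aestronglyMeasurable_restrict_of_continuousOn {F : Type*} [TopologicalSpace F]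
    [TopologicalSpace.PseudoMetrizableSpace F] [SecondCountableTopologyEither (E d) F]
    (hΩ : IsOpen Ω) (hT : T ⊆ Ω) {f : E d → F} (hf : ContinuousOn f Ω) :
    AEStronglyMeasurable f (volume.restrict T) :=
  (hf.aestronglyMeasurable hΩ.measurableSet).mono_measure (Measure.restrict_mono hT le_rfl)

lemma diam_le_size (M : PolyMesh Ω) (hT : T ∈ M.elems) : Metric.diam T ≤ M.size :=
  le_ciSup (f := fun T : M.elems => Metric.diam (T : Set (E d))) (Set.finite_range _).bddAbove
    ⟨T, hT⟩

/-- The contribution of one element to the square of the norm `|||v|||`. -/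
def elemNormSq (ε c0 : ℝ) (b : E d → E d) (δT : ℝ) (T : Set (E d)) (v : E d → ℝ) : ℝ :=
  ε * seminormH 1 T v ^ 2 + c0 * normL2 T v ^ 2 +
    δT * normL2 T (fun x => inner ℝ (b x) (wgrad T v x)) ^ 2

lemma mul_le_sqrt_of_sq_le {a D S : ℝ} (h : a ^ 2 * D ^ 2 ≤ S) : a * D ≤ √S :=
  Real.le_sqrt_of_sq_le (by rwa [mul_pow])

/-- Converts one multiplied-out bound on δ_T to the square-root form used in the balance; since a is
never divided by, it may vanish. -/
lemma mul_sqrt_le_of_mul_le {a s q A H : ℝ} (hs : 0 ≤ s) (hq : 0 < q) (hA : 0 ≤ A) (hH : 0 ≤ H)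
    (h : s * (q * a ^ 2) ≤ A * H ^ 2) : a * √s ≤ √(A / q) * H := by
  refine abs_le_of_sq_le_sq' ?_ (by positivity) |>.2
  rw [mul_pow, mul_pow, Real.sq_sqrt hs, Real.sq_sqrt (by positivity), div_mul_eq_mul_div,
    le_div_iff₀ hq]
  linarith

set_option maxHeartbeats 1000000 in
/-- The consistency error on one element. -/
theorem exists_abs_AT_le (hd : 0 < d) {k : ℕ} (hk : 1 ≤ k) (hΩ : IsOpen Ω) {ρ : ℝ} (hρ : 0 < ρ)
    {b : E d → E d} (hb : ContDiffOn ℝ 1 b Ω)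
    (hb' : ∃ B : ℝ, ∀ x ∈ Ω, ‖b x‖ ≤ B ∧ ‖fderiv ℝ b x‖ ≤ B)
    {c : E d → ℝ} (hc : ContinuousOn c Ω) (hc' : ∃ B : ℝ, ∀ x ∈ Ω, |c x| ≤ B) {c0 : ℝ} (hc0 : 0 < c0)
    {αs γs ss cI μ₁ μ₂ : ℝ} (hαs : 0 < αs) (hγs : 0 < γs) (hss : 0 < ss) (hcI : 0 < cI)
    (hμ₁ : 0 < μ₁) (hμ₂ : 0 < μ₂) {Cp : ℝ} (hCp : 0 < Cp) :
    ∃ C : ℝ, 0 < C ∧ ∀ {T : Set (E d)}, IsOpen T → Bornology.IsBounded T → T.Nonempty → T ⊆ Ω →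
      (∃ (x : E d) (r : ℝ), ρ * Metric.diam T ≤ r ∧ ∀ y ∈ Metric.ball x r, StarConvex ℝ y T) →
      ∀ {ε : ℝ}, 0 < ε → ∀ {δT : ℝ}, 0 < δT →
      δT * (4 * supNorm Ω c ^ 2) ≤ c0 * min ss γs →
      δT * (2 * ε * μ₁ ^ 2) ≤ Metric.diam T ^ 2 * αs →
      δT * (4 * supNorm Ω b ^ 2 * μ₂ ^ 2) ≤
        min 1 (1 / cI) * (c0 * min ss γs) * Metric.diam T ^ 2 →
      ∀ {u : E d → ℝ}, MemH (k + 1) T u → ∀ {p : MvPolynomial (Fin d) ℝ}, p.totalDegree ≤ k →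
      normL2 T (fun x => u x - pval p x) +
        Metric.diam T * seminormH 1 T (fun x => u x - pval p x) ≤
          Cp * Metric.diam T ^ (k + 1) * seminormH (k + 1) T u →
      ∀ {v : E d → ℝ}, MemH 1 T v →
      |AT ε b c δT T (fun x => pval p x - u x) v| ≤ C * (√(eta ε δT (Metric.diam T)) *
        (Metric.diam T ^ k * seminormH (k + 1) T u) * √(elemNormSq ε c0 b δT T v)) := by
  obtain ⟨C2, hC2, hlap⟩ := exists_normL2_wlap_le d hd hk hρ hCp
  obtain ⟨B, hB⟩ := hb'
  have hm : 0 < min ss γs := lt_min hss hγs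
  have hm1 : 0 < min 1 (1 / cI) := lt_min one_pos (by positivity)
  set β := supNorm Ω b with hβdef
  set γ := supNorm Ω c with hγdef
  have hβ0 : 0 ≤ β := supNorm_nonneg b
  have hγ0 : 0 ≤ γ := supNorm_nonneg c
  have hβ : ∀ x ∈ Ω, ‖b x‖ ≤ β := le_supNorm ⟨B, fun x hx => (hB x hx).1⟩
  have hγ : ∀ x ∈ Ω, |c x| ≤ γ := le_supNorm (f := c) hc'
  -- The absolute value keeps the constant nonnegative even when Ω has no points.
  set B' := d * |B| with hB'
  have hB0 : 0 ≤ B' := by positivity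
  have hdB : ∀ x ∈ Ω, |dvg b x| ≤ B' := fun x hx =>
    abs_dvg_le ((hB x hx).2.trans (le_abs_self B))
  -- The three bounds on δ_T, with their data factors removed: these constants do not depend on ε,
  -- δ_T or the element.
  set κ := √(min 1 (1 / cI) * (c0 * min ss γs) / (4 * μ₂ ^ 2)) with hκ
  set κ₂ := √(αs / (2 * μ₁ ^ 2)) with hκ₂
  set κ₃ := √(c0 * min ss γs / 4) with hκ₃
  have hsc : 0 < √c0 := Real.sqrt_pos.2 hc0
  refine ⟨Cp + 1 / 2 * (κ * Cp / √c0 + Cp + B' * Cp / √c0) + γ * Cp / √c0 + κ₂ * C2 + κ * Cp +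
    κ₃ * Cp, by positivity, ?_⟩
  intro T hT hTb hne hTΩ hstar ε hε δT hδ h1 h2 h3 u hu p hp hup v hv
  have hH := diam_pos_of_isOpen hd hT hTb hne
  have hl := fun h0 => hlap hT hTb hne hstar hu hp h0
  set H := Metric.diam T
  set X := seminormH (k + 1) T u
  have hX : 0 ≤ X := seminormH_nonneg _ _
  set w : E d → ℝ := fun x => pval p x - u x with hw
  have hW : normL2 T w + H * seminormH 1 T w ≤ Cp * H ^ (k + 1) * X := by
    have e1 : seminormH 1 T w = seminormH 1 T (fun x => u x - pval p x) := by
      refine (pow_left_inj₀ (seminormH_nonneg _ _) (seminormH_nonneg _ _) two_ne_zero).1 ?_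
      rw [sq_seminormH_pval_sub hTb hT (by omega) hu, sq_seminormH_sub_pval hTb hT (by omega) hu]
    rw [e1, hw, normL2_sub_comm]
    exact hup
  have hW0 : 0 ≤ normL2 T w := normL2_nonneg _
  have hW1 : 0 ≤ seminormH 1 T w := seminormH_nonneg _ _
  have hW2 := hl (by
    have := mul_nonneg hH.le (seminormH_nonneg (T := T) 1 (fun x => u x - pval p x))
    linarith)
  have hu1 : ∀ i, HasL2WeakDeriv T ![i] u := fun i => hu.2 1 (by omega) _
  have hAT := abs_AT_le hε.le hδ.le hβ0 hγ0 hB0 hT.measurableSet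
    (aestronglyMeasurable_restrict_of_continuousOn hΩ hTΩ hb.continuousOn)
    (fun x hx => hβ x (hTΩ hx))
    (aestronglyMeasurable_restrict_of_continuousOn hΩ hTΩ (continuousOn_dvg hΩ hb))
    (fun x hx => hdB x (hTΩ hx))
    (aestronglyMeasurable_restrict_of_continuousOn hΩ hTΩ hc) (fun x hx => hγ x (hTΩ hx))
    ((memLp_pval hTb hT p).sub hu.1) hv.1
    (fun i => hasL2WeakDeriv_pval_sub hTb hT hu.1 (hu1 i) p) (fun i => hv.2 1 le_rfl _)
    (memLp_wlap_pval_sub hTb hT (hu.mono (by omega)) p)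
  refine hAT.trans ?_
  set Db := normL2 T (fun x => inner ℝ (b x) (wgrad T v x)) with hDb
  set N := √(elemNormSq ε c0 b δT T v) with hN
  have hD1' : 0 ≤ ε * seminormH 1 T v ^ 2 := by positivity
  have hD0' : 0 ≤ c0 * normL2 T v ^ 2 := by positivity
  have hDb' : 0 ≤ δT * Db ^ 2 := by positivity
  have hNe : elemNormSq ε c0 b δT T v =
    ε * seminormH 1 T v ^ 2 + c0 * normL2 T v ^ 2 + δT * Db ^ 2 := rfl
  have heta : eta ε δT H = ε + H ^ 2 + H ^ 2 / δT + δT + H ^ 2 / ε := rfl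
  have q1 : 0 ≤ H ^ 2 / δT := by positivity
  have q2 : 0 ≤ H ^ 2 / ε := by positivity
  have q3 : 0 ≤ H ^ 2 := by positivity
  -- The argument `hsc` puts √c0 in the role of the coercivity weight.
  refine consistency_algebra (e := √ε) (s := √δT) (H := H) hCp.le (Real.sqrt_nonneg _)
    (Real.sqrt_nonneg _) (Real.sqrt_nonneg _) hB0 hsc (Real.sqrt_nonneg _) (Real.sqrt_pos.2 hδ)
    (by positivity) hγ0 hβ0 (Real.sq_sqrt hε.le).symm (Real.sq_sqrt hδ.le).symm hW0 hW1
    (normL2_nonneg _) (normL2_nonneg _) ?_ ?_ hW2 ?_ ?_ ?_ (Real.sqrt_nonneg _) ?_ ?_ ?_ ?_ ?_ ?_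
  · calc normL2 T w ≤ Cp * H ^ (k + 1) * X := by linarith [mul_nonneg hH.le hW1]
      _ = _ := by ring
  · refine le_of_mul_le_mul_left ?_ hH
    calc H * seminormH 1 T w ≤ Cp * H ^ (k + 1) * X := by linarith
      _ = _ := by ring
  · exact mul_le_sqrt_of_sq_le (by rw [Real.sq_sqrt hε.le, hNe]; linarith)
  · exact mul_le_sqrt_of_sq_le (by rw [Real.sq_sqrt hc0.le, hNe]; linarith)
  · exact mul_le_sqrt_of_sq_le (by rw [Real.sq_sqrt hδ.le, hNe]; linarith)
  · exact Real.sqrt_le_sqrt (by rw [heta]; linarith)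
  · exact Real.le_sqrt_of_sq_le (by rw [heta]; linarith)
  -- H ≤ √η_T √δ_T is the reason for the summand H² / δ_T in the weight.
  · rw [← Real.sqrt_mul (by rw [heta]; positivity)]
    refine Real.le_sqrt_of_sq_le ?_
    calc H ^ 2 = H ^ 2 / δT * δT := by field_simp
      _ ≤ _ := mul_le_mul_of_nonneg_right (by rw [heta]; linarith) hδ.le
  · exact mul_sqrt_le_of_mul_le hδ.le (by positivity) (by positivity) hH.le
      ((by ring : δT * (4 * μ₂ ^ 2 * β ^ 2) = δT * (4 * β ^ 2 * μ₂ ^ 2)).trans_le h3)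
  · refine mul_sqrt_le_of_mul_le hδ.le (by positivity) hαs.le hH.le ?_
    rw [Real.sq_sqrt hε.le, mul_comm αs]
    exact (by ring : δT * (2 * μ₁ ^ 2 * ε) = δT * (2 * ε * μ₁ ^ 2)).trans_le h2
  -- The bound involving c carries no power of the mesh size, hence the value 1.
  · have := mul_sqrt_le_of_mul_le (a := γ) (q := 4) (A := c0 * min ss γs) (H := 1) hδ.le
      (by norm_num) (by positivity) zero_le_one (by rw [one_pow, mul_one]; exact h1)
    rwa [mul_one] at this

lemma totalDegree_le_of_mem_Poly {k : ℕ} {p : MvPolynomial (Fin d) ℝ} (h : p ∈ Poly d k) :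
    p.totalDegree ≤ k := by
  rcases h with rfl | h
  · simp
  · exact_mod_cast h

end Global

end NCVEM

end

/-! ### Summation over the mesh. -/

theorem mainTheorem4 (d : ℕ) (hd : d = 2 ∨ d = 3) (k : ℕ) (hk : 1 ≤ k)
    (Ω : Set (NCVEM.E d)) (hΩ : NCVEM.IsPolytopalDomain Ω) (ρ : ℝ) (hρ : 0 < ρ)
    (b : NCVEM.E d → NCVEM.E d) (hb : ContDiffOn ℝ 1 b Ω)
    (hb' : ∃ B : ℝ, ∀ x ∈ Ω, ‖b x‖ ≤ B ∧ ‖fderiv ℝ b x‖ ≤ B)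
    (c : NCVEM.E d → ℝ) (hc : ContinuousOn c Ω) (hc' : ∃ B : ℝ, ∀ x ∈ Ω, |c x| ≤ B)
    (c0 : ℝ) (hc0 : 0 < c0) (hcoer : ∀ x ∈ Ω, c0 ≤ c x - (1 / 2) * NCVEM.dvg b x)
    (αs γs ss cI μ₁ μ₂ : ℝ) (hαs : 0 < αs) (hγs : 0 < γs) (hss : 0 < ss) (hcI : 0 < cI)
    (hμ₁ : 0 < μ₁) (hμ₂ : 0 < μ₂) :
    (∃ Cp : ℝ, 0 < Cp ∧ ∀ M : NCVEM.PolyMesh Ω, M.Regular ρ →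
      ∀ u : NCVEM.E d → ℝ, M.MemH (k + 1) u →
        ∃ up : Set (NCVEM.E d) → MvPolynomial (Fin d) ℝ, M.IsPolyApprox k Cp u up) ∧
    ∀ Cp : ℝ, 0 < Cp → ∃ C : ℝ, 0 < C ∧ ∀ M : NCVEM.PolyMesh Ω, M.Regular ρ →
      ∀ ε : ℝ, 0 < ε → ∀ δT : Set (NCVEM.E d) → ℝ,
        M.ControlParam ε c0 b c αs γs ss cI μ₁ μ₂ δT →
      ∀ u : NCVEM.E d → ℝ, M.MemH (k + 1) u →
      ∀ up : Set (NCVEM.E d) → MvPolynomial (Fin d) ℝ, M.IsPolyApprox k Cp u up →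
      ∀ δ : NCVEM.E d → ℝ, M.MemV k δ →
        |∑ T ∈ M.elems,
            NCVEM.AT ε b c (δT T) T (fun x => NCVEM.pval (up T) x - u x) δ| ≤
          C * M.size ^ k *
            √(∑ T ∈ M.elems,
              NCVEM.eta ε (δT T) (Metric.diam T) * NCVEM.seminormH (k + 1) T u ^ 2) *
            M.tnorm ε c0 b δT δ := by
  have hd0 : 0 < d := by omega
  constructor
  · have hK := NCVEM.bhConst_pos d hρ
    refine ⟨√(NCVEM.bhConst d ρ) ^ (k + 1) + √(NCVEM.bhConst d ρ) ^ k, by positivity, ?_⟩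
    intro M hM u hu
    have h : ∀ T, ∃ q : MvPolynomial (Fin d) ℝ, T ∈ M.elems → q.totalDegree ≤ k ∧
        NCVEM.normL2 T (fun x => u x - NCVEM.pval q x) +
          Metric.diam T * NCVEM.seminormH 1 T (fun x => u x - NCVEM.pval q x) ≤
        (√(NCVEM.bhConst d ρ) ^ (k + 1) + √(NCVEM.bhConst d ρ) ^ k) * Metric.diam T ^ (k + 1) *
          NCVEM.seminormH (k + 1) T u := fun T => by
      by_cases hT : T ∈ M.elems
      · have hP := M.elem_poly T hT
        obtain ⟨q, hq⟩ := NCVEM.exists_polynomial_approx hd0 hP.isOpen hP.bounded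
          hP.connected.nonempty hρ (hM.z2 T hT) (hu.2 T hT)
        exact ⟨q, fun _ => hq⟩
      -- The polynomial attached to a set outside the mesh is irrelevant.
      · exact ⟨0, fun h => absurd h hT⟩
    choose up hup using h
    exact ⟨up, fun T hT => ⟨Or.inr (by exact_mod_cast (hup T hT).1), (hup T hT).2⟩⟩
  · intro Cp hCp
    obtain ⟨C, hC, hAT⟩ := NCVEM.exists_abs_AT_le hd0 hk hΩ.isOpen hρ hb hb' hc hc' hc0 hαs hγs hss
      hcI hμ₁ hμ₂ hCp
    refine ⟨C, hC, ?_⟩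
    intro M hM ε hε δT hδT u hu up hup δ hδ
    set X : Set (NCVEM.E d) → ℝ := fun T => NCVEM.seminormH (k + 1) T u with hX
    set r : Set (NCVEM.E d) → ℝ := fun T => √(NCVEM.eta ε (δT T) (Metric.diam T)) with hr
    set N : Set (NCVEM.E d) → ℝ := fun T => √(NCVEM.elemNormSq ε c0 b (δT T) T δ) with hN
    have hsz : 0 ≤ M.size := Real.iSup_nonneg fun _ => Metric.diam_nonneg
    have hX0 : ∀ T, 0 ≤ X T := fun T => NCVEM.seminormH_nonneg _ _
    have key : ∀ T ∈ M.elems,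
        |NCVEM.AT ε b c (δT T) T (fun x => NCVEM.pval (up T) x - u x) δ| ≤
          C * M.size ^ k * (r T * X T * N T) := fun T hT => by
      have hP := M.elem_poly T hT
      obtain ⟨h0, h1, h2, h3⟩ := hδT T hT
      refine (hAT hP.isOpen hP.bounded hP.connected.nonempty (M.elem_subset T hT) (hM.z2 T hT) hε
        h0 h1 h2 h3 (hu.2 T hT) (NCVEM.totalDegree_le_of_mem_Poly (hup T hT).1) (hup T hT).2
        (hδ.1.1.2 T hT)).trans ?_
      have hpow : Metric.diam T ^ k ≤ M.size ^ k :=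
        pow_le_pow_left₀ Metric.diam_nonneg (NCVEM.diam_le_size M hT) k
      calc C * (r T * (Metric.diam T ^ k * X T) * N T)
          = C * Metric.diam T ^ k * (r T * X T * N T) := by ring
        _ ≤ C * M.size ^ k * (r T * X T * N T) :=
            mul_le_mul_of_nonneg_right (mul_le_mul_of_nonneg_left hpow hC.le)
              (mul_nonneg (mul_nonneg (Real.sqrt_nonneg _) (hX0 T)) (Real.sqrt_nonneg _))
    have hsq1 : ∑ T ∈ M.elems, (r T * X T) ^ 2 = ∑ T ∈ M.elems,
        NCVEM.eta ε (δT T) (Metric.diam T) * NCVEM.seminormH (k + 1) T u ^ 2 :=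
      Finset.sum_congr rfl fun T hT => by
        have h0 := (hδT T hT).1
        rw [mul_pow, hr, Real.sq_sqrt (by unfold NCVEM.eta; positivity)]
    have hsq2 : √(∑ T ∈ M.elems, N T ^ 2) = M.tnorm ε c0 b δT δ := by
      rw [NCVEM.PolyMesh.tnorm]
      refine congrArg _ (Finset.sum_congr rfl fun T hT => ?_)
      have h0 := (hδT T hT).1
      rw [hN, Real.sq_sqrt (by unfold NCVEM.elemNormSq; positivity)]
      rfl
    calc |∑ T ∈ M.elems, NCVEM.AT ε b c (δT T) T (fun x => NCVEM.pval (up T) x - u x) δ|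
        ≤ ∑ T ∈ M.elems, C * M.size ^ k * (r T * X T * N T) :=
          (Finset.abs_sum_le_sum_abs _ _).trans (Finset.sum_le_sum key)
      _ = C * M.size ^ k * ∑ T ∈ M.elems, r T * X T * N T := by rw [Finset.mul_sum]
      -- Discrete Cauchy–Schwarz, grouping the weight with the seminorm of u and leaving the local
      -- norms to assemble |||δ|||.
      _ ≤ C * M.size ^ k * (√(∑ T ∈ M.elems, (r T * X T) ^ 2) * √(∑ T ∈ M.elems, N T ^ 2)) :=
          mul_le_mul_of_nonneg_left (Real.sum_mul_le_sqrt_mul_sqrt _ _ _) (by positivity)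
      _ = _ := by rw [hsq1, hsq2]; ring
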